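/- Let $\Sigma$ be a finite alphabet. For words $u,w\in\Sigma^*$ write $u\sqsubseteq w$ if $u$ is a (scattered) subword of $w$, write $u\sqsubset w$ if moreover $u\ne w$, and say that $w$ covers $u$ if $u\sqsubset w$ and there is no word $v$ with $u\sqsubset v\sqsubset w$. Let $\mathcal S$ be the structure with universe $\Sigma^*$, the binary relations $\sqsubseteq$ and "is covered by", and a unary predicate $L$ for every regular language $L\subseteq\Sigma^*$. The logic $\mathrm{C{+}MOD}$ extends first-order logic (with equality) by the quantifiers $\exists^{\ge k}x$ for $k\in\mathbb N$ and $\exists^{p\bmod q}x$ for $p,q\in\mathbb N$ with $p<q$: $\mathcal S\models\exists^{\ge k}x\,\alpha$ iff $|\{w\in\Sigma^*\mid\mathcal S\models\alpha(w)\}|\ge k$, and $\mathcal S\models\exists^{p\bmod q}x\,\alpha$ iff $|\{w\in\Sigma^*\mid\mathcal S\models\alpha(w)\}|\in p+q\mathbb N$ (so in particular this set is finite). $\mathrm{C{+}MOD}^2$ is the set of those formulas that use only two variables $x$ and $y$, each of which may be quantified repeatedly. In formulas, each regular language is given by a finite automaton accepting it, so that formulas are finite objects. Theorem. For every $\mathrm{C{+}MOD}^2$-formula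 $\varphi(x)$ in the language of $\mathcal S$ with no free variable other than $x$, the set $\{w\in\Sigma^*\mid \mathcal S\models\varphi(w)\}$ is effectively regular: it is regular, and there is an algorithm (depending only on $\Sigma$) that computes from any such formula $\varphi$ a finite automaton accepting this set. -/

import Mathlib

namespace SubwordLogic

universe u v

/-! ### Words -/

section Words

variable {A : Type u}

/-- `Subword u w`: `u` is a scattered subword of `w`. -/
def Subword (u w : List A) : Prop := u.Sublist w

/-- `u` is a subword of `w` and `u ≠ w`. -/
def ProperSubword (u w : List A) : Prop := Subword u w ∧ u ≠ w

/-- `w` is a cover of `u`: `u` is a proper subword of `w` and there is no word properly between. -/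
def Cover (u w : List A) : Prop :=
  ProperSubword u w ∧ ¬ ∃ v, ProperSubword u v ∧ ProperSubword v w

end Words

/-! ### Finite descriptions of regular languages -/

/-- A finite automaton over the alphabet `A` as a finite object: the list of initial states, the
list of transitions `(source, letter, target)`, and the list of accepting states. States are
natural numbers. -/
abbrev AutomatonCode (A : Type u) : Type u := List ℕ × List (ℕ × A × ℕ) × List ℕ

/-- The nondeterministic automaton described by a code. Its state type is `ℕ`, but only the
finitely many numbers listed in the code matter. -/
def AutomatonCode.toNFA {A : Type u} (M : AutomatonCode A) : NFA A ℕ where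
  start := {i | i ∈ M.1}
  step i a := {j | (i, a, j) ∈ M.2.1}
  accept := {i | i ∈ M.2.2}

/-- The language accepted by the automaton with a given code. -/
def AutomatonCode.language {A : Type u} (M : AutomatonCode A) : Language A := M.toNFA.accepts

/-- The languages that have a code are exactly the regular languages. -/
theorem AutomatonCode.exists_language_eq_iff {A : Type u} [Finite A] (L : Language A) :
    (∃ M : AutomatonCode A, M.language = L) ↔ L.IsRegular := by
  constructor
  · rintro ⟨M, rfl⟩
    apply Language.IsRegular.of_finite_range_leftQuotient
    have hfin : ({i | i ∈ M.1} ∪ {j | ∃ t ∈ M.2.1, t.2.2 = j} : Set ℕ).Finite := by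
      refine (List.finite_toSet M.1).union ?_
      exact (List.finite_toSet M.2.1).image (fun t => t.2.2)
    refine (hfin.finite_subsets.image (fun S => M.toNFA.acceptsFrom S)).subset ?_
    rintro _ ⟨w, rfl⟩
    refine ⟨M.toNFA.evalFrom M.toNFA.start w, ?_, ?_⟩
    · rcases List.eq_nil_or_concat w with rfl | ⟨w, a, rfl⟩
      · exact fun i hi => Or.inl hi
      · intro j hj
        rw [List.concat_eq_append, NFA.evalFrom_append, NFA.evalFrom_singleton, NFA.mem_stepSet] at hj
        obtain ⟨i, -, hi⟩ := hj
        exact Or.inr ⟨_, hi, rfl⟩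
    · ext y
      change _ ↔ w ++ y ∈ M.toNFA.acceptsFrom M.toNFA.start
      rw [NFA.append_mem_acceptsFrom]
  · rintro ⟨σ, hσ, D, rfl⟩
    classical
    cases nonempty_fintype A
    let e : σ → ℕ := fun s => (Fintype.equivFin σ s : ℕ)
    have he : Function.Injective e := Fin.val_injective.comp (Fintype.equivFin σ).injective
    let M : AutomatonCode A := ([e D.start],
      (Finset.univ : Finset (σ × A)).toList.map (fun t => (e t.1, t.2, e (D.step t.1 t.2))),
      ((Finset.univ : Finset σ).filter (· ∈ D.accept)).toList.map e)
    have hstep : ∀ s a, M.toNFA.step (e s) a = {e (D.step s a)} := by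
      intro s a
      ext j
      simp only [AutomatonCode.toNFA, M, Set.mem_ofPred_eq, List.mem_map, Finset.mem_toList,
        Finset.mem_univ, true_and, Prod.mk.injEq, Prod.exists, Set.mem_singleton_iff]
      constructor
      · rintro ⟨s', a', h1, rfl, rfl⟩
        rw [he h1]
      · rintro rfl
        exact ⟨s, a, rfl, rfl, rfl⟩
    have heval : ∀ w s, M.toNFA.evalFrom {e s} w = {e (D.evalFrom s w)} := by
      intro w
      induction w with
      | nil => intro s; simp
      | cons a w ih => intro s; rw [NFA.evalFrom_cons, NFA.stepSet_singleton, hstep, ih]; rfl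
    refine ⟨M, ?_⟩
    have hstart : M.toNFA.start = {e D.start} := by
      ext j; simp [AutomatonCode.toNFA, M]
    ext w
    change w ∈ M.toNFA.accepts ↔ _
    rw [NFA.mem_accepts, hstart, heval, DFA.mem_accepts]
    simp only [Set.mem_singleton_iff, exists_eq_right, AutomatonCode.toNFA, M, Set.mem_ofPred_eq,
      List.mem_map, Finset.mem_toList, Finset.mem_filter, Finset.mem_univ, true_and]
    constructor
    · rintro ⟨s, hs, h⟩
      rw [he h] at hs
      exact hs
    · exact fun h => ⟨_, h, rfl⟩

/-! ### The logic C+MOD over words -/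

/-- Formulas of first-order logic with threshold and modulo counting quantifiers (C+MOD), with
variables from `V`, in the signature of the structure `(A*, ⊑, cover, (L)_{L regular})`.
The unary predicate of a regular language is written down by means of an automaton for it, so that
a formula is a finite object. -/
inductive Formula (A : Type u) (V : Type v) : Type (max u v)
  | eq (s t : V) : Formula A V
  | subword (s t : V) : Formula A V
  | cover (s t : V) : Formula A V
  | mem (t : V) (M : AutomatonCode A) : Formula A V
  | not (φ : Formula A V) : Formula A V
  | and (φ ψ : Formula A V) : Formula A V
  | ex (z : V) (φ : Formula A V) : Formula A V
  | exAtLeast (k : ℕ) (z : V) (φ : Formula A V) : Formula A V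
  | exMod (p q : ℕ) (hpq : p < q) (z : V) (φ : Formula A V) : Formula A V

/-- The two-variable fragment C+MOD²: the formulas that use only two variables. -/
abbrev Formula2 (A : Type u) : Type u := Formula A (Fin 2)

namespace Formula

variable {A : Type u} {V : Type v}

/-- The free variables of a formula. -/
def freeVars : Formula A V → Set V
  | eq s t => {s, t}
  | subword s t => {s, t}
  | cover s t => {s, t}
  | mem t _ => {t}
  | not φ => φ.freeVars
  | and φ ψ => φ.freeVars ∪ ψ.freeVars
  | ex z φ => φ.freeVars \ {z}
  | exAtLeast _ z φ => φ.freeVars \ {z}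
  | exMod _ _ _ z φ => φ.freeVars \ {z}

/-- `φ.Holds s`: the structure `(A*, ⊑, cover, (L)_{L regular})` satisfies `φ` under the
assignment `s`. Quantifiers range over all words; `Set.encard` is the cardinality in `ℕ ∪ {∞}`. -/
def Holds [DecidableEq V] : Formula A V → (V → List A) → Prop
  | eq x y, s => s x = s y
  | subword x y, s => Subword (s x) (s y)
  | cover x y, s => Cover (s x) (s y)
  | mem x M, s => s x ∈ M.language
  | not φ, s => ¬ φ.Holds s
  | and φ ψ, s => φ.Holds s ∧ ψ.Holds s
  | ex z φ, s => ∃ w : List A, φ.Holds (Function.update s z w)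
  | exAtLeast k z φ, s => (k : ℕ∞) ≤ {w : List A | φ.Holds (Function.update s z w)}.encard
  | exMod p q _ z φ, s =>
      ∃ m : ℕ, {w : List A | φ.Holds (Function.update s z w)}.encard = ((p + q * m : ℕ) : ℕ∞)

/-- The set of words `w` such that `φ` holds when `x` is interpreted by `w`. (If no variable other
than `x` is free in `φ`, the values of the other variables are irrelevant.) -/
def definedSet [DecidableEq V] (φ : Formula A V) (x : V) : Language A :=
  {w : List A | ∀ s : V → List A, s x = w → φ.Holds s}

/-- Gödel numbering of formulas. -/
def code [Encodable A] [Encodable V] : Formula A V → ℕ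
  | eq s t => Nat.pair 0 (Nat.pair (Encodable.encode s) (Encodable.encode t))
  | subword s t => Nat.pair 1 (Nat.pair (Encodable.encode s) (Encodable.encode t))
  | cover s t => Nat.pair 2 (Nat.pair (Encodable.encode s) (Encodable.encode t))
  | mem t M => Nat.pair 3 (Nat.pair (Encodable.encode t) (Encodable.encode M))
  | not φ => Nat.pair 4 φ.code
  | and φ ψ => Nat.pair 5 (Nat.pair φ.code ψ.code)
  | ex z φ => Nat.pair 6 (Nat.pair (Encodable.encode z) φ.code)
  | exAtLeast k z φ => Nat.pair 7 (Nat.pair k (Nat.pair (Encodable.encode z) φ.code))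
  | exMod p q _ z φ =>
      Nat.pair 8 (Nat.pair p (Nat.pair q (Nat.pair (Encodable.encode z) φ.code)))

theorem code_injective [Encodable A] [Encodable V] :
    Function.Injective (code : Formula A V → ℕ) := by
  intro φ
  induction φ <;> intro ψ hψ <;> cases ψ <;> simp [code, Nat.pair_eq_pair] at hψ ⊢ <;> grind

end Formula

end SubwordLogic

/-!
Throughout, an automaton reads words from right to left; its state map is a function `F` on words
for which `F u = F v` implies `F (a :: u) = F (a :: v)` (`IsLeftCongr`).

*Regularity.* By induction on a formula `φ` with variables `x` and `y`, its truth value depends only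
on the states that `x` and `y` reach in some finite automaton and on the binary atomic formulas that
hold for `(x, y)` (`Recognized`, `Recognized.holds`). The step for a counting quantifier over `y`
rests on the fact that being a superword, being a subword and being incomparable are unambiguous
rational relations: the words that are in one of these relations to `a :: x` arise in exactly one
way by putting a block of letters in front of a word that is in one of these relations to `x`
(`mem_region_cons_iff`, `blocks_unambiguous`). To achieve this, superwords of `x` are read off from
the rightmost embedding of `x`, and subwords from their rightmost embedding into `x`; for
incomparable words, say `x.length ≤ y.length` with `x` not a subword of `y`, one strips letters from
the front of both words until the rest of `x` first is a subword of the rest of `y`. Hence the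
numbers of witnesses in a given state, as elements of the semiring `ℕ∞`, depend linearly on those
for the tail of `x` (`encard_regionIn_cons`). Counting only up to a threshold and a modulus is a
congruence of finite index on `ℕ∞` (`Approx`), so that the resulting vector of classes is again a
state map (`Recognized.count`).

*Effectiveness.* The construction bounds the number of states by a primitive recursive function of
the code of `φ` (`stateBound`). For a fixed value of one variable, the set of witnesses for the
other one is recognized by an automaton of bounded size as well (`Recognized.exists_section`).
Therefore, by pumping, it is infinite if and only if it contains a word within a certain range of
lengths, and otherwise it contains no long words (`IsLeftCongr.encard_eq`). So all quantifiers can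
be evaluated on words of bounded length, and the formulas with small codes are tabulated on longer
and longer words (`mem_table_iff`). Since the number of states is bounded, an automaton for the
defined set can finally be written down from the membership of finitely many words, as in the
Myhill-Nerode theorem (`syntacticAutomaton_language`).
-/

namespace SubwordLogic

universe u

/-! ### Counting up to a threshold and a modulus -/

/-- Two extended natural numbers are `Approx K q` if they are equal, or both are finite, at least
`K`, and congruent modulo `q`. For `1 ≤ K` this is a congruence of finite index on the semiring
`ℕ∞`. -/
def Approx (K q : ℕ) (a b : ℕ∞) : Prop :=
  a = b ∨ ∃ m n : ℕ, a = m ∧ b = n ∧ K ≤ m ∧ K ≤ n ∧ m ≡ n [MOD q]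

namespace Approx

variable {K q : ℕ} {a b c d : ℕ∞}

theorem refl (a : ℕ∞) : Approx K q a a := Or.inl rfl

theorem add_left (h : Approx K q a b) (c : ℕ∞) : Approx K q (c + a) (c + b) := by
  obtain rfl | ⟨m, n, rfl, rfl, hm, hn, hmn⟩ := h
  · exact refl _
  · induction c using ENat.recTopCoe with
    | top => left; simp
    | coe c =>
      exact Or.inr ⟨c + m, c + n, by push_cast; rfl, by push_cast; rfl, by omega, by omega,
        Nat.ModEq.add_left c hmn⟩

theorem trans (h : Approx K q a b) (h' : Approx K q b c) : Approx K q a c := by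
  obtain rfl | ⟨m, n, rfl, rfl, hm, hn, hmn⟩ := h
  · exact h'
  · obtain rfl | ⟨m', n', h, rfl, hm', hn', hmn'⟩ := h'
    · exact Or.inr ⟨m, n, rfl, rfl, hm, hn, hmn⟩
    · obtain rfl : n = m' := by exact_mod_cast h
      exact Or.inr ⟨m, n', rfl, rfl, hm, hn', hmn.trans hmn'⟩

theorem add (h : Approx K q a b) (h' : Approx K q c d) : Approx K q (a + c) (b + d) := by
  have h1 := h.add_left c
  have h2 := h'.add_left b
  rw [add_comm c a, add_comm c b] at h1
  exact h1.trans h2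

theorem sum {ι : Type*} (s : Finset ι) {f g : ι → ℕ∞} (h : ∀ i ∈ s, Approx K q (f i) (g i)) :
    Approx K q (∑ i ∈ s, f i) (∑ i ∈ s, g i) := by
  classical
  induction s using Finset.induction_on with
  | empty => exact refl _
  | insert i s hi ih =>
    rw [Finset.sum_insert hi, Finset.sum_insert hi]
    exact (h i (Finset.mem_insert_self i s)).add
      (ih fun j hj => h j (Finset.mem_insert_of_mem hj))

/-- The hypothesis `1 ≤ K` separates `0` from all other numbers, as `⊤ * 0 = 0`. -/
theorem mul_left (hK : 1 ≤ K) (h : Approx K q a b) (c : ℕ∞) : Approx K q (c * a) (c * b) := by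
  obtain rfl | ⟨m, n, rfl, rfl, hm, hn, hmn⟩ := h
  · exact refl _
  · induction c using ENat.recTopCoe with
    | top =>
      left
      rw [ENat.top_mul (by simp; omega), ENat.top_mul (by simp; omega)]
    | coe c =>
      obtain rfl | hc := Nat.eq_zero_or_pos c
      · left; simp
      · exact Or.inr ⟨c * m, c * n, by push_cast; rfl, by push_cast; rfl, by nlinarith,
          by nlinarith, Nat.ModEq.mul_left c hmn⟩

theorem le_iff (h : Approx K q a b) : (K : ℕ∞) ≤ a ↔ (K : ℕ∞) ≤ b := by
  obtain rfl | ⟨m, n, rfl, rfl, hm, hn, hmn⟩ := h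
  · rfl
  · simp [hm, hn]

theorem exists_eq_add_mul {p : ℕ} (hp : p < q) (h : Approx K q a b)
    (ha : ∃ m : ℕ, a = ((p + q * m : ℕ) : ℕ∞)) : ∃ m : ℕ, b = ((p + q * m : ℕ) : ℕ∞) := by
  obtain rfl | ⟨m, n, rfl, rfl, hm, hn, hmn⟩ := h
  · exact ha
  · obtain ⟨l, hl⟩ := ha
    obtain rfl : m = p + q * l := by exact_mod_cast hl
    refine ⟨n / q, ?_⟩
    have h1 : (p + q * l) % q = n % q := hmn
    rw [Nat.add_mul_mod_self_left, Nat.mod_eq_of_lt hp] at h1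
    rw [h1, Nat.mod_add_div]

end Approx

/-- The class of an extended natural number modulo `Approx K q`. -/
noncomputable def approxClass (K q : ℕ) (a : ℕ∞) : Fin (K + q + 1) :=
  Fin.ofNat _ (if a = ⊤ then K + q else if a.toNat < K then a.toNat else K + (a.toNat - K) % q)

theorem approxClass_eq_iff {K q : ℕ} (hq : 1 ≤ q) {a b : ℕ∞} :
    approxClass K q a = approxClass K q b ↔ Approx K q a b := by
  have hval : ∀ m : ℕ, (approxClass K q m).val = if m < K then m else K + (m - K) % q := by
    intro m
    have := Nat.mod_lt (m - K) hq
    have hlt : (if m < K then m else K + (m - K) % q) < K + q + 1 := by split_ifs <;> omega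
    simp only [approxClass, ENat.natCast_ne_top, if_false, ENat.toNat_natCast, Fin.val_ofNat]
    exact Nat.mod_eq_of_lt hlt
  have htop : (approxClass K q ⊤).val = K + q := by
    simp only [approxClass, if_true, Fin.val_ofNat]
    exact Nat.mod_eq_of_lt (by omega)
  have hlt : ∀ m : ℕ, (approxClass K q m).val < K + q := by
    intro m
    have := Nat.mod_lt (m - K) hq
    rw [hval]
    split_ifs <;> omega
  induction a using ENat.recTopCoe with
  | top =>
    induction b using ENat.recTopCoe with
    | top => simp [Approx.refl]
    | coe n =>
      refine ⟨fun h => ?_, ?_⟩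
      · have := hlt n
        rw [← h, htop] at this
        omega
      · rintro (h | ⟨m, n, h, -⟩) <;> simp at h
  | coe m =>
    induction b using ENat.recTopCoe with
    | top =>
      refine ⟨fun h => ?_, ?_⟩
      · have := hlt m
        rw [h, htop] at this
        omega
      · rintro (h | ⟨m, n, h, h', -⟩)
        · simp at h
        · simp at h'
    | coe n =>
      rw [Fin.ext_iff, hval, hval]
      have hmod : K ≤ m → K ≤ n → ((m - K) % q = (n - K) % q ↔ m ≡ n [MOD q]) := by
        intro hm hn
        conv_rhs => rw [← Nat.sub_add_cancel hm, ← Nat.sub_add_cancel hn]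
        exact ⟨fun h => Nat.ModEq.add_right K h, fun h => Nat.ModEq.add_right_cancel' K h⟩
      constructor
      · intro h
        split_ifs at h with h1 h2 h2
        · left; rw [h]
        · omega
        · omega
        · push Not at h1 h2
          exact Or.inr ⟨m, n, rfl, rfl, h1, h2, (hmod h1 h2).1 (by omega)⟩
      · rintro (h | ⟨m', n', hm', hn', h1, h2, h3⟩)
        · obtain rfl : m = n := by exact_mod_cast h
          rfl
        · obtain rfl : m = m' := by exact_mod_cast hm'
          obtain rfl : n = n' := by exact_mod_cast hn'
          rw [if_neg (by omega), if_neg (by omega), (hmod h1 h2).2 h3]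

/-! ### Unambiguous decomposition of the subword order -/

section Regions

open scoped List

variable {A : Type u}

/-- Names for the relations between words that are counted along one of the words. The number
`d : Fin 3` is a difference of lengths, truncated at `2`. -/
inductive Branch (A : Type u)
  | up (o : Option A) (d : Fin 3)
  | down (o : Option A) (d : Fin 3)
  | longer
  | shorter
  deriving DecidableEq, Fintype

/-- The difference of two lengths, truncated at `2`. -/
def lengthGap (x y : List A) : Fin 3 :=
  ⟨min 2 (y.length - x.length), by omega⟩

/-- The words in a given relation to `x`.
`up o d`: the superwords `y` of `x` that are `d` letters longer; if `o = some a`, then `a :: x` must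
not be a subword of `y`.
`down o d`: the subwords `y` of `x` that are `d` letters shorter; if `o = some b`, then `b :: y` must
not be a subword of `x`.
`longer` and `shorter`: the words `y` incomparable with `x`, with `x.length ≤ y.length` and
`y.length < x.length` respectively. -/
def region : Branch A → List A → Set (List A)
  | .up o d, x => {y | x <+ y ∧ (∀ a ∈ o, ¬ (a :: x) <+ y) ∧ lengthGap x y = d}
  | .down o d, x => {y | y <+ x ∧ (∀ b ∈ o, ¬ (b :: y) <+ x) ∧ lengthGap y x = d}
  | .longer, x => {y | x.length ≤ y.length ∧ ¬ x <+ y}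
  | .shorter, x => {y | y.length < x.length ∧ ¬ y <+ x}

/-- The words that are put in front of a word of `region j x` to obtain the words of
`region i (a :: x)`. -/
def blocks (a : A) : Branch A → Branch A → Set (List A)
  | .up o d, .up o' d' =>
    {u | o' = some a ∧ ∃ z, u = z ++ [a] ∧ (∀ b ∈ o, b ∉ z) ∧ min 2 (z.length + d'.val) = d.val}
  | .down o d, .down o' d' =>
    {u | (u = [] ∧ o' = o ∧ o ≠ some a ∧ min 2 (d'.val + 1) = d.val) ∨
      (u = [a] ∧ o' = some a ∧ d' = d)}
  | .longer, .longer => {u | ∃ b, u = [b]}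
  | .longer, .up o' _ => {u | o' = some a ∧ ∃ b, b ≠ a ∧ u = [b]}
  | .shorter, .shorter => {u | ∃ b, u = [b]}
  | .shorter, .down o' d' => {u | ∃ b, b ≠ a ∧ u = [b] ∧ o' = some b ∧ d'.val ≠ 0}
  | _, _ => ∅

theorem cons_sublist_iff_of_ne {a b : A} (h : a ≠ b) {x y : List A} :
    (a :: x) <+ (b :: y) ↔ (a :: x) <+ y := by
  rw [List.cons_sublist_cons']
  simp [h]

/-- The rightmost embedding: a superword of `a :: x` has a shortest suffix of the form `a :: y` with
`x <+ y`. -/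
theorem exists_rightmost {a : A} {x y : List A} (h : (a :: x) <+ y) :
    ∃ z y', y = z ++ a :: y' ∧ x <+ y' ∧ ¬ (a :: x) <+ y' := by
  induction y with
  | nil => simp at h
  | cons b y ih =>
    by_cases h' : (a :: x) <+ y
    · obtain ⟨z, y', rfl, h1, h2⟩ := ih h'
      exact ⟨b :: z, y', rfl, h1, h2⟩
    · rw [List.cons_sublist_cons'] at h
      obtain h | ⟨rfl, h⟩ := h
      · exact absurd h h'
      · exact ⟨[], y, rfl, h, h'⟩

/-- If `y` is a superword of `x` but not of `b :: x`, then every embedding of `b :: x` into `z ++ y`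
maps `b` into `z`. -/
theorem cons_sublist_append_iff {b : A} {x z y : List A} (hy : x <+ y) (hb : ¬ (b :: x) <+ y) :
    (b :: x) <+ z ++ y ↔ b ∈ z := by
  induction z with
  | nil => simpa using hb
  | cons c z ih =>
    rw [List.cons_append, List.cons_sublist_cons', ih]
    have : x <+ z ++ y := hy.trans (List.sublist_append_right z y)
    simp only [this, and_true, List.mem_cons]
    tauto

/-- The words of a region of `a :: x` are obtained from those of the regions of `x` by putting blocks
in front. For `longer`, the first letter of `y` is stripped together with `a`; the tail `y'` of `y`
is either again incomparable with `x`, or it is a superword of `x` but not of `a :: x`. For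
`shorter`, the roles of the two words are exchanged. -/
theorem mem_region_cons_iff (i : Branch A) (a : A) (x y : List A) :
    y ∈ region i (a :: x) ↔ ∃ j, ∃ u ∈ blocks a i j, ∃ y' ∈ region j x, u ++ y' = y := by
  cases i with
  | up o d =>
    constructor
    · rintro ⟨h1, h2, h3⟩
      obtain ⟨z, y', rfl, h4, h5⟩ := exists_rightmost h1
      refine ⟨.up (some a) (lengthGap x y'), z ++ [a], ⟨rfl, z, rfl, ?_, ?_⟩, y',
        ⟨h4, by simpa using h5, rfl⟩, by simp⟩
      · intro b hb hz
        apply h2 b hb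
        exact (List.singleton_sublist.2 hz).append (h4.cons_cons a)
      · rw [← h3]
        have := h4.length_le
        simp only [lengthGap, List.length_append, List.length_cons]
        omega
    · rintro ⟨j, u, hu, y', hy', rfl⟩
      cases j with
      | up o' d' =>
        obtain ⟨rfl, z, rfl, hz, hd⟩ := hu
        obtain ⟨h1, h2, h3⟩ := hy'
        have h2 : ¬ (a :: x) <+ y' := h2 a rfl
        have h4 : (a :: x) <+ (a :: y') := h1.cons_cons a
        rw [List.append_assoc, List.singleton_append]
        refine ⟨h4.trans (List.sublist_append_right _ _), fun b hb h => hz b hb ?_, ?_⟩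
        · refine (cons_sublist_append_iff h4 ?_).1 h
          intro h5
          rw [List.cons_sublist_cons'] at h5
          obtain h5 | ⟨-, h5⟩ := h5
          · exact h2 ((List.sublist_cons_self b _).trans h5)
          · exact h2 h5
        · have := h1.length_le
          rw [← h3] at hd
          ext
          rw [← hd]
          simp only [lengthGap, List.length_append, List.length_cons]
          omega
      | _ => exact hu.elim
  | down o d =>
    constructor
    · rintro ⟨h1, h2, h3⟩
      by_cases h4 : y <+ x
      · refine ⟨.down o (lengthGap y x), [], Or.inl ⟨rfl, rfl, ?_, ?_⟩, y,
          ⟨h4, fun b hb h => h2 b hb (h.trans (List.sublist_cons_self _ _)), rfl⟩, rfl⟩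
        · rintro rfl
          exact h2 a rfl (h4.cons_cons a)
        · rw [← h3]
          have := h4.length_le
          simp only [lengthGap, List.length_cons]
          omega
      · cases y with
        | nil => simp at h4
        | cons b y =>
          have h5 := h1
          rw [List.cons_sublist_cons'] at h5
          obtain h5 | ⟨rfl, h5⟩ := h5
          · exact absurd h5 h4
          · refine ⟨.down (some b) d, [b], Or.inr ⟨rfl, rfl, rfl⟩, y,
              ⟨h5, by simpa using h4, ?_⟩, rfl⟩
            rw [← h3]
            simp [lengthGap]
    · rintro ⟨j, u, hu, y', hy', rfl⟩
      cases j with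
      | down o' d' =>
        obtain ⟨rfl, rfl, hne, hd⟩ | ⟨rfl, rfl, rfl⟩ := hu
        · obtain ⟨h1, h2, h3⟩ := hy'
          refine ⟨h1.cons a, fun b hb h => h2 b hb ?_, ?_⟩
          · refine (cons_sublist_iff_of_ne ?_).1 h
            rintro rfl
            exact hne hb
          · have := h1.length_le
            rw [← h3] at hd
            ext
            rw [← hd]
            simp only [lengthGap, List.nil_append, List.length_cons]
            omega
        · obtain ⟨h1, h2, h3⟩ := hy'
          have h2 : ¬ (a :: y') <+ x := h2 a rfl
          refine ⟨h1.cons_cons a, fun b hb h => h2 ?_, ?_⟩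
          · rw [List.singleton_append, List.cons_sublist_cons'] at h
            obtain h | ⟨-, h⟩ := h
            · exact (List.sublist_cons_self b _).trans h
            · exact h
          · rw [← h3]
            simp [lengthGap]
      | _ => exact hu.elim
  | longer =>
    constructor
    · rintro ⟨h1, h2⟩
      cases y with
      | nil => simp at h1
      | cons b y =>
        by_cases h3 : x <+ y
        · refine ⟨.up (some a) (lengthGap x y), [b], ⟨rfl, b, ?_, rfl⟩, y, ⟨h3, ?_, rfl⟩, rfl⟩
          · rintro rfl
            exact h2 (h3.cons_cons b)
          · simp only [Option.mem_some_iff, forall_eq']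
            exact fun h => h2 (h.cons b)
        · exact ⟨.longer, [b], ⟨b, rfl⟩, y, ⟨by simpa using h1, h3⟩, rfl⟩
    · rintro ⟨j, u, hu, y', hy', rfl⟩
      cases j with
      | up o' d' =>
        obtain ⟨rfl, b, hb, rfl⟩ := hu
        obtain ⟨h1, h2, h3⟩ := hy'
        refine ⟨by simpa using h1.length_le, fun h => h2 a rfl ?_⟩
        exact (cons_sublist_iff_of_ne hb.symm).1 h
      | longer =>
        obtain ⟨b, rfl⟩ := hu
        obtain ⟨h1, h2⟩ := hy'
        refine ⟨by simpa using h1, fun h => h2 ?_⟩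
        rw [List.singleton_append, List.cons_sublist_cons'] at h
        obtain h | ⟨-, h⟩ := h
        · exact (List.sublist_cons_self a _).trans h
        · exact h
      | _ => exact hu.elim
  | shorter =>
    constructor
    · rintro ⟨h1, h2⟩
      cases y with
      | nil => simp at h2
      | cons b y =>
        have h1 : y.length < x.length := by simpa using h1
        by_cases h3 : y <+ x
        · refine ⟨.down (some b) (lengthGap y x), [b], ⟨b, ?_, rfl, rfl, ?_⟩, y, ⟨h3, ?_, rfl⟩, rfl⟩
          · rintro rfl
            exact h2 (h3.cons_cons b)
          · simp only [lengthGap]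
            omega
          · simp only [Option.mem_some_iff, forall_eq']
            exact fun h => h2 (h.cons a)
        · exact ⟨.shorter, [b], ⟨b, rfl⟩, y, ⟨h1, h3⟩, rfl⟩
    · rintro ⟨j, u, hu, y', hy', rfl⟩
      cases j with
      | down o' d' =>
        obtain ⟨b, hb, rfl, rfl, hd⟩ := hu
        obtain ⟨h1, h2, h3⟩ := hy'
        refine ⟨?_, fun h => h2 b rfl ?_⟩
        · rw [← h3] at hd
          simp only [lengthGap] at hd
          simp only [List.length_append, List.length_cons, List.length_nil]
          omega
        · exact (cons_sublist_iff_of_ne hb).1 h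
      | shorter =>
        obtain ⟨b, rfl⟩ := hu
        obtain ⟨h1, h2⟩ := hy'
        refine ⟨by simpa using h1, fun h => h2 ?_⟩
        rw [List.singleton_append, List.cons_sublist_cons'] at h
        obtain h | ⟨-, h⟩ := h
        · exact (List.sublist_cons_self b _).trans h
        · exact h
      | _ => exact hu.elim

/-- The decomposition in `mem_region_cons_iff` is unambiguous. -/
theorem blocks_unambiguous {i j j' : Branch A} {a : A} {x u u' y y' : List A}
    (hu : u ∈ blocks a i j) (hu' : u' ∈ blocks a i j') (hy : y ∈ region j x)
    (hy' : y' ∈ region j' x) (h : u ++ y = u' ++ y') : j = j' ∧ u = u' ∧ y = y' := by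
  cases i with
  | up o d =>
    cases j with
    | up o1 d1 =>
      cases j' with
      | up o2 d2 =>
        obtain ⟨rfl, z, rfl, -, -⟩ := hu
        obtain ⟨rfl, z', rfl, -, -⟩ := hu'
        -- if one of the two suffixes were longer, it would contain `a :: x`
        have key : ∀ {z z' y y' : List A}, x <+ y' → ¬ (a :: x) <+ y →
            z ++ [a] ++ y = z' ++ [a] ++ y' → z'.length ≤ z.length := by
          intro z z' y y' hy' hy h
          by_contra! hlt
          apply hy
          have h1 : y = (z' ++ [a] ++ y').drop (z.length + 1) := by
            rw [← h]
            exact (List.drop_left' (by simp)).symm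
          rw [h1, List.append_assoc, List.drop_append_of_le_length (by omega)]
          exact (hy'.cons_cons a).trans (List.sublist_append_right _ _)
        have hl : z.length = z'.length :=
          le_antisymm (key hy.1 (hy'.2.1 a rfl) h.symm) (key hy'.1 (hy.2.1 a rfl) h)
        obtain ⟨h1, rfl⟩ := List.append_inj h (by simp [hl])
        refine ⟨?_, h1, rfl⟩
        rw [← hy.2.2, ← hy'.2.2]
      | _ => exact hu'.elim
    | _ => exact hu.elim
  | down o d =>
    cases j with
    | down o1 d1 =>
      cases j' with
      | down o2 d2 =>
        obtain ⟨rfl, rfl, hne, -⟩ | ⟨rfl, rfl, rfl⟩ := hu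
        · obtain ⟨rfl, rfl, -, -⟩ | ⟨rfl, rfl, rfl⟩ := hu'
          · obtain rfl : y = y' := h
            exact ⟨by rw [← hy.2.2, ← hy'.2.2], rfl, rfl⟩
          · obtain rfl : y = a :: y' := h
            exact absurd hy.1 (hy'.2.1 a rfl)
        · obtain ⟨rfl, rfl, -, -⟩ | ⟨rfl, rfl, rfl⟩ := hu'
          · obtain rfl : a :: y = y' := h
            exact absurd hy'.1 (hy.2.1 a rfl)
          · exact ⟨rfl, rfl, by simpa using h⟩
      | _ => exact hu'.elim
    | _ => exact hu.elim
  | longer =>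
    cases j with
    | up o1 d1 =>
      obtain ⟨rfl, b, -, rfl⟩ := hu
      cases j' with
      | up o2 d2 =>
        obtain ⟨rfl, b', -, rfl⟩ := hu'
        obtain ⟨rfl, rfl⟩ : b = b' ∧ y = y' := by simpa using h
        exact ⟨by rw [← hy.2.2, ← hy'.2.2], rfl, rfl⟩
      | longer =>
        obtain ⟨b', rfl⟩ := hu'
        obtain ⟨rfl, rfl⟩ : b = b' ∧ y = y' := by simpa using h
        exact absurd hy.1 hy'.2
      | _ => exact hu'.elim
    | longer =>
      obtain ⟨b, rfl⟩ := hu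
      cases j' with
      | up o2 d2 =>
        obtain ⟨rfl, b', -, rfl⟩ := hu'
        obtain ⟨rfl, rfl⟩ : b = b' ∧ y = y' := by simpa using h
        exact absurd hy'.1 hy.2
      | longer =>
        obtain ⟨b', rfl⟩ := hu'
        obtain ⟨rfl, rfl⟩ : b = b' ∧ y = y' := by simpa using h
        exact ⟨rfl, rfl, rfl⟩
      | _ => exact hu'.elim
    | _ => exact hu.elim
  | shorter =>
    cases j with
    | down o1 d1 =>
      obtain ⟨b, -, rfl, rfl, -⟩ := hu
      cases j' with
      | down o2 d2 =>
        obtain ⟨b', -, rfl, rfl, -⟩ := hu'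
        obtain ⟨rfl, rfl⟩ : b = b' ∧ y = y' := by simpa using h
        exact ⟨by rw [← hy.2.2, ← hy'.2.2], rfl, rfl⟩
      | shorter =>
        obtain ⟨b', rfl⟩ := hu'
        obtain ⟨rfl, rfl⟩ : b = b' ∧ y = y' := by simpa using h
        exact absurd hy.1 hy'.2
      | _ => exact hu'.elim
    | shorter =>
      obtain ⟨b, rfl⟩ := hu
      cases j' with
      | down o2 d2 =>
        obtain ⟨b', -, rfl, rfl, -⟩ := hu'
        obtain ⟨rfl, rfl⟩ : b = b' ∧ y = y' := by simpa using h
        exact absurd hy'.1 hy.2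
      | shorter =>
        obtain ⟨b', rfl⟩ := hu'
        obtain ⟨rfl, rfl⟩ : b = b' ∧ y = y' := by simpa using h
        exact ⟨rfl, rfl, rfl⟩
      | _ => exact hu'.elim
    | _ => exact hu.elim

end Regions

/-! ### Left congruences and the effect of counting quantifiers -/

section Recognition

open scoped List

variable {A : Type u}

/-- `F` is the state map of an automaton that reads words from right to left. -/
def IsLeftCongr {τ : Type*} (F : List A → τ) : Prop :=
  ∀ (a : A) (u v : List A), F u = F v → F (a :: u) = F (a :: v)

theorem IsLeftCongr.append {τ : Type*} {F : List A → τ} (hF : IsLeftCongr F) (w : List A)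
    {u v : List A} (h : F u = F v) : F (w ++ u) = F (w ++ v) := by
  induction w with
  | nil => exact h
  | cons a w ih => exact hF a _ _ ih

/-- In the subword order, a cover adds exactly one letter. -/
theorem cover_iff {u w : List A} : Cover u w ↔ u <+ w ∧ w.length = u.length + 1 := by
  constructor
  · rintro ⟨⟨h, hne⟩, hcov⟩
    refine ⟨h, ?_⟩
    have h' : u <+ w := h
    have hlen : u.length < w.length := by
      refine lt_of_le_of_ne h'.length_le fun he => hne (h'.eq_of_length he)
    by_contra hlen'
    clear h
    -- remove one letter of `w` outside an embedded copy of `u`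
    have key : ∀ {u w : List A}, u <+ w → u.length < w.length →
        ∃ v, u <+ v ∧ v <+ w ∧ w.length = v.length + 1 := by
      intro u w h
      induction h with
      | slnil => simp
      | @cons l₁ l₂ a h ih => exact fun _ => ⟨l₂, h, List.sublist_cons_self _ _, rfl⟩
      | @cons_cons l₁ l₂ a h ih =>
        intro hl
        obtain ⟨v, h1, h2, h3⟩ := ih (by simpa using hl)
        exact ⟨a :: v, h1.cons_cons a, h2.cons_cons a, by simp [h3]⟩
    obtain ⟨v, h1, h2, h3⟩ := key h' hlen
    refine hcov ⟨v, ⟨h1, ?_⟩, ⟨h2, ?_⟩⟩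
    · rintro rfl
      omega
    · rintro rfl
      omega
  · rintro ⟨h, hlen⟩
    refine ⟨⟨h, ?_⟩, ?_⟩
    · rintro rfl
      omega
    · rintro ⟨v, ⟨h1, h2⟩, h3, h4⟩
      have h1 : u <+ v := h1
      have h3 : v <+ w := h3
      have := lt_of_le_of_ne h1.length_le fun he => h2 (h1.eq_of_length he)
      have := lt_of_le_of_ne h3.length_le fun he => h4 (h3.eq_of_length he)
      omega

/-- The pairs `(x, y)` and `(x', y')` satisfy the same binary atomic formulas. -/
def SameType (x y x' y' : List A) : Prop :=
  (x <+ y ↔ x' <+ y') ∧ (y <+ x ↔ y' <+ x') ∧ (Cover x y ↔ Cover x' y') ∧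
    (Cover y x ↔ Cover y' x')

theorem SameType.symm {x y x' y' : List A} (h : SameType x y x' y') : SameType x' y' x y :=
  ⟨h.1.symm, h.2.1.symm, h.2.2.1.symm, h.2.2.2.symm⟩

theorem SameType.swap {x y x' y' : List A} (h : SameType x y x' y') : SameType y x y' x' :=
  ⟨h.2.1, h.1, h.2.2.2, h.2.2.1⟩

theorem SameType.eq_iff {x y x' y' : List A} (h : SameType x y x' y') : x = y ↔ x' = y' := by
  have key : ∀ u v : List A, u = v ↔ u <+ v ∧ v <+ u := fun u v =>
    ⟨fun h => ⟨h ▸ List.Sublist.refl u, h ▸ List.Sublist.refl u⟩, fun h => h.1.antisymm h.2⟩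
  rw [key, key, h.1, h.2.1]

/-- The relation `P` is determined by the atomic type of a pair of words and the states that the
two words reach in an automaton with `N` states reading from right to left. -/
def Recognized (N : ℕ) (P : List A → List A → Prop) : Prop :=
  ∃ F : List A → Fin N, IsLeftCongr F ∧ ∀ x y x' y', F x = F x' → F y = F y' →
    SameType x y x' y' → P x y → P x' y'

theorem IsLeftCongr.comp {τ τ' : Type*} {F : List A → τ} (hF : IsLeftCongr F) {e : τ → τ'}
    (he : Function.Injective e) : IsLeftCongr (e ∘ F) :=
  fun a u v h => congrArg e (hF a u v (he h))

theorem exists_injective_fin {τ : Type*} [Fintype τ] {N : ℕ} (hN : Fintype.card τ ≤ N) :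
    ∃ e : τ → Fin N, Function.Injective e :=
  ⟨fun t => Fin.castLE hN (Fintype.equivFin τ t),
    (Fin.castLE_injective hN).comp (Fintype.equivFin τ).injective⟩

theorem Recognized.of_fintype {τ : Type*} [Fintype τ] {N : ℕ} (hN : Fintype.card τ ≤ N)
    {F : List A → τ} (hF : IsLeftCongr F) {P : List A → List A → Prop}
    (h : ∀ x y x' y', F x = F x' → F y = F y' → SameType x y x' y' → P x y → P x' y') :
    Recognized N P := by
  obtain ⟨e, he⟩ := exists_injective_fin hN
  exact ⟨e ∘ F, hF.comp he, fun x y x' y' hx hy => h x y x' y' (he hx) (he hy)⟩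

variable {N M : ℕ} {P Q : List A → List A → Prop}

theorem Recognized.mono (h : Recognized N P) (hNM : N ≤ M) : Recognized M P := by
  obtain ⟨F, hF, h⟩ := h
  exact Recognized.of_fintype (by simpa using hNM) hF h

theorem Recognized.swap (h : Recognized N P) : Recognized N fun x y => P y x := by
  obtain ⟨F, hF, h⟩ := h
  exact ⟨F, hF, fun x y x' y' hx hy ht => h y x y' x' hy hx ht.swap⟩

theorem Recognized.not (h : Recognized N P) : Recognized N fun x y => ¬ P x y := by
  obtain ⟨F, hF, h⟩ := h
  exact ⟨F, hF, fun x y x' y' hx hy ht hP hP' => hP (h x' y' x y hx.symm hy.symm ht.symm hP')⟩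

theorem Recognized.and (h : Recognized N P) (h' : Recognized M Q) :
    Recognized (N * M) fun x y => P x y ∧ Q x y := by
  obtain ⟨F, hF, h⟩ := h
  obtain ⟨G, hG, h'⟩ := h'
  refine Recognized.of_fintype (τ := Fin N × Fin M) (by simp) (F := fun x => (F x, G x)) ?_ ?_
  · intro a u v huv
    simp only [Prod.mk.injEq] at huv ⊢
    exact ⟨hF a u v huv.1, hG a u v huv.2⟩
  · intro x y x' y' hx hy ht hPQ
    simp only [Prod.mk.injEq] at hx hy
    exact ⟨h x y x' y' hx.1 hy.1 ht hPQ.1, h' x y x' y' hx.2 hy.2 ht hPQ.2⟩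

/-- The branches whose regions partition the set of all words. The gap `0` is left to `up`. -/
def Branch.IsMain : Branch A → Prop
  | .up o _ => o = none
  | .down o d => o = none ∧ d ≠ 0
  | .longer => True
  | .shorter => True

theorem exists_isMain_mem_region (x y : List A) : ∃ i : Branch A, i.IsMain ∧ y ∈ region i x := by
  by_cases h1 : x <+ y
  · exact ⟨.up none (lengthGap x y), rfl, h1, by simp, rfl⟩
  · by_cases h2 : y <+ x
    · refine ⟨.down none (lengthGap y x), ⟨rfl, fun h => h1 ?_⟩, h2, by simp, rfl⟩
      have h3 := congrArg Fin.val h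
      simp only [lengthGap, Fin.val_zero] at h3
      rw [h2.eq_of_length_le (by omega)]
    · by_cases h3 : x.length ≤ y.length
      · exact ⟨.longer, trivial, h3, h1⟩
      · exact ⟨.shorter, trivial, by omega, h2⟩

theorem not_sublist_of_mem_down {x y : List A} {o : Option A} {d : Fin 3} (hd : d ≠ 0)
    (h : y ∈ region (.down o d) x) : ¬ x <+ y := by
  intro h'
  have := h'.length_le
  apply hd
  rw [← h.2.2]
  ext
  simp only [lengthGap, Fin.val_zero]
  omega

theorem not_sublist_of_mem_longer {x y : List A} (h : y ∈ region .longer x) : ¬ y <+ x :=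
  fun h' => h.2 (h'.eq_of_length_le h.1 ▸ List.Sublist.refl _)

theorem not_sublist_of_mem_shorter {x y : List A} (h : y ∈ region .shorter x) : ¬ x <+ y :=
  fun h' => absurd h'.length_le (not_le.2 h.1)

theorem Branch.IsMain.eq_of_mem {i j : Branch A} (hi : i.IsMain) (hj : j.IsMain) {x y : List A}
    (h : y ∈ region i x) (h' : y ∈ region j x) : i = j := by
  cases i with
  | up o d =>
    obtain rfl : o = none := hi
    cases j with
    | up o' d' =>
      obtain rfl : o' = none := hj
      rw [← h.2.2, ← h'.2.2]
    | down o' d' => exact absurd h.1 (not_sublist_of_mem_down hj.2 h')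
    | longer => exact absurd h.1 h'.2
    | shorter => exact absurd h.1 (not_sublist_of_mem_shorter h')
  | down o d =>
    obtain rfl : o = none := hi.1
    cases j with
    | up o' d' => exact absurd h'.1 (not_sublist_of_mem_down hi.2 h)
    | down o' d' =>
      obtain rfl : o' = none := hj.1
      rw [← h.2.2, ← h'.2.2]
    | longer => exact absurd h.1 (not_sublist_of_mem_longer h')
    | shorter => exact absurd h.1 h'.2
  | longer =>
    cases j with
    | up o' d' => exact absurd h'.1 h.2
    | down o' d' => exact absurd h'.1 (not_sublist_of_mem_longer h)
    | longer => rfl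
    | shorter => exact absurd h'.1 (not_lt.2 h.1)
  | shorter =>
    cases j with
    | up o' d' => exact absurd h'.1 (not_sublist_of_mem_shorter h)
    | down o' d' => exact absurd h'.1 h.2
    | longer => exact absurd h.1 (not_lt.2 h'.1)
    | shorter => rfl

theorem lengthGap_eq_one_iff {x y : List A} : lengthGap x y = 1 ↔ y.length = x.length + 1 := by
  rw [Fin.ext_iff]
  simp only [lengthGap, Fin.val_one]
  omega

/-- The main branch that contains `y` determines the atomic formulas that hold for `(x, y)`. -/
theorem Branch.IsMain.sameType {i : Branch A} (hi : i.IsMain) {x y x' y' : List A}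
    (h : y ∈ region i x) (h' : y' ∈ region i x') : SameType x y x' y' := by
  have hup : ∀ {x y : List A} {o d}, y ∈ region (.up o d) x → (y <+ x ↔ d = 0) := by
    intro x y o d h
    have hxy : x <+ y := h.1
    rw [← h.2.2, Fin.ext_iff]
    simp only [lengthGap, Fin.val_zero]
    constructor
    · intro h2
      have := h2.length_le
      omega
    · intro h2
      rw [hxy.eq_of_length_le (by omega)]
  simp only [SameType, cover_iff]
  cases i with
  | up o d =>
    have e1 := hup h
    have e2 := hup h'
    have l1 := lengthGap_eq_one_iff (x := x) (y := y)
    have l2 := lengthGap_eq_one_iff (x := x') (y := y')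
    rw [h.2.2] at l1
    rw [h'.2.2] at l2
    have n1 := h.1.length_le
    have n2 := h'.1.length_le
    simp only [iff_true_intro h.1, iff_true_intro h'.1, e1, e2, true_and, ← l1, ← l2]
    omega
  | down o d =>
    have e1 := not_sublist_of_mem_down hi.2 h
    have e2 := not_sublist_of_mem_down hi.2 h'
    have l1 := lengthGap_eq_one_iff (x := y) (y := x)
    have l2 := lengthGap_eq_one_iff (x := y') (y := x')
    rw [h.2.2] at l1
    rw [h'.2.2] at l2
    simp [h.1, h'.1, e1, e2, ← l1, ← l2]
  | longer => simp [h.2, h'.2, not_sublist_of_mem_longer h, not_sublist_of_mem_longer h']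
  | shorter => simp [h.2, h'.2, not_sublist_of_mem_shorter h, not_sublist_of_mem_shorter h']

/-- The words of a region that lead to a given state. -/
def regionIn {τ : Type*} (F : List A → τ) (i : Branch A × τ) (x : List A) : Set (List A) :=
  {y | y ∈ region i.1 x ∧ F y = i.2}

/-- The blocks that lead from one state to another. -/
def blocksIn {τ : Type*} (F : List A → τ) (a : A) (i j : Branch A × τ) : Set (List A) :=
  {u | u ∈ blocks a i.1 j.1 ∧ ∃ y, F y = j.2 ∧ F (u ++ y) = i.2}

/-- The numbers of words in the regions of `a :: x` depend linearly on those for `x`. -/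
theorem encard_regionIn_cons [Fintype A] {τ : Type*} [Fintype τ] {F : List A → τ}
    (hF : IsLeftCongr F) (i : Branch A × τ) (a : A) (x : List A) :
    (regionIn F i (a :: x)).encard =
      ∑ j, (blocksIn F a i j).encard * (regionIn F j x).encard := by
  classical
  have hset : regionIn F i (a :: x) =
      ⋃ j, (fun q : List A × List A => q.1 ++ q.2) '' (blocksIn F a i j ×ˢ regionIn F j x) := by
    ext y
    simp only [Set.mem_iUnion, Set.mem_image, Set.mem_prod, Prod.exists]
    constructor
    · rintro ⟨h1, h2⟩
      obtain ⟨j, u, hu, y', hy', rfl⟩ := (mem_region_cons_iff _ _ _ _).1 h1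
      exact ⟨j, F y', u, y', ⟨⟨hu, y', rfl, h2⟩, hy', rfl⟩, rfl⟩
    · rintro ⟨j, p, u, y', ⟨⟨hu, y'', hp, hi⟩, hy', hp'⟩, rfl⟩
      refine ⟨(mem_region_cons_iff _ _ _ _).2 ⟨j, u, hu, y', hy', rfl⟩, ?_⟩
      rw [← hi]
      exact hF.append u (hp'.trans hp.symm)
  rw [hset, Set.encard_iUnion_of_finite, finsum_eq_sum_of_fintype]
  · refine Finset.sum_congr rfl fun j _ => ?_
    rw [Set.InjOn.encard_image, Set.encard_prod]
    rintro ⟨u, y⟩ ⟨⟨hu, -⟩, hy, -⟩ ⟨u', y'⟩ ⟨⟨hu', -⟩, hy', -⟩ h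
    obtain ⟨-, rfl, rfl⟩ := blocks_unambiguous hu hu' hy hy' h
    rfl
  · intro j j' hne
    refine Set.disjoint_left.2 ?_
    rintro _ ⟨⟨u, y⟩, ⟨⟨hu, -⟩, hy, hp⟩, rfl⟩ ⟨⟨u', y'⟩, ⟨⟨hu', -⟩, hy', hp'⟩, h⟩
    obtain ⟨h1, -, rfl⟩ := blocks_unambiguous hu' hu hy' hy h
    exact hne (Prod.ext h1.symm (hp.symm.trans hp'))

/-- Counting quantifiers preserve recognizability: `R` stands for the condition on the number of
witnesses. -/
theorem Recognized.count [Fintype A] (h : Recognized N P) {K q : ℕ} (hK : 1 ≤ K) (hq : 1 ≤ q)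
    {R : ℕ∞ → Prop} (hR : ∀ a b, Approx K q a b → R a → R b) :
    Recognized (N * (K + q + 1) ^ (Fintype.card (Branch A) * N))
      fun x _ => R {y | P x y}.encard := by
  classical
  obtain ⟨F, hF, h⟩ := h
  let G : List A → Fin N × (Branch A × Fin N → Fin (K + q + 1)) :=
    fun x => (F x, fun i => approxClass K q (regionIn F i x).encard)
  have hG : ∀ x x', G x = G x' ↔ F x = F x' ∧
      ∀ i, Approx K q (regionIn F i x).encard (regionIn F i x').encard := by
    intro x x'
    simp only [G, Prod.mk.injEq, funext_iff, approxClass_eq_iff hq]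
  refine Recognized.of_fintype (F := G) ?_ ?_ ?_
  · simp
  · intro a u v huv
    rw [hG] at huv ⊢
    refine ⟨hF a u v huv.1, fun i => ?_⟩
    rw [encard_regionIn_cons hF, encard_regionIn_cons hF]
    exact Approx.sum _ fun j _ => (huv.2 j).mul_left hK _
  · intro x _ x' _ hx _ _ hx'
    rw [hG] at hx
    refine hR _ _ ?_ hx'
    -- the indices of the regions that consist of witnesses
    let S : Set (Branch A × Fin N) := {i | i.1.IsMain ∧ ∃ x₀ y₀, F x₀ = F x ∧ F y₀ = i.2 ∧
      y₀ ∈ region i.1 x₀ ∧ P x₀ y₀}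
    have key : ∀ x', F x' = F x →
        {y | P x' y}.encard = ∑ i, if i ∈ S then (regionIn F i x').encard else 0 := by
      intro x' hx'
      have hset : {y | P x' y} = ⋃ i, if i ∈ S then regionIn F i x' else ∅ := by
        ext y
        simp only [Set.mem_iUnion]
        constructor
        · intro hy
          obtain ⟨i, hi, hyi⟩ := exists_isMain_mem_region x' y
          refine ⟨(i, F y), ?_⟩
          rw [if_pos ⟨hi, x', y, hx', rfl, hyi, hy⟩]
          exact ⟨hyi, rfl⟩
        · rintro ⟨i, hi⟩
          split_ifs at hi with hS
          · obtain ⟨hm, x₀, y₀, hx₀, hy₀, hr, hP⟩ := hS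
            exact h _ _ _ _ (hx₀.trans hx'.symm) (hy₀.trans hi.2.symm) (hm.sameType hr hi.1) hP
          · exact hi.elim
      rw [hset, Set.encard_iUnion_of_finite, finsum_eq_sum_of_fintype]
      · refine Finset.sum_congr rfl fun i _ => ?_
        split_ifs <;> simp
      · intro i j hne
        refine Set.disjoint_left.2 fun y hy hy' => hne ?_
        dsimp only at hy hy'
        split_ifs at hy hy' with hi hj
        · exact Prod.ext (hi.1.eq_of_mem hj.1 hy.1 hy'.1) (hy.2.symm.trans hy'.2)
        all_goals first | exact hy.elim | exact hy'.elim
    rw [key x rfl, key x' hx.1.symm]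
    refine Approx.sum _ fun i _ => ?_
    split_ifs
    · exact hx.2 i
    · exact Approx.refl _

end Recognition

/-! ### Pumping for left congruences -/

section Pumping

open scoped List

variable {A : Type u} {s : ℕ} {F : List A → Fin s}

/-- Pigeonhole principle for the suffixes of `w` of length at most `s`. -/
theorem IsLeftCongr.exists_repetition (w : List A) (h : s ≤ w.length) :
    ∃ u v t, w = u ++ (v ++ t) ∧ v ≠ [] ∧ v.length ≤ s ∧ F (v ++ t) = F t := by
  obtain ⟨k, l, hne, hkl⟩ := Fintype.exists_ne_map_eq_of_card_lt
    (fun k : Fin (s + 1) => F (w.drop (w.length - k))) (by simp)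
  wlog hlt : k < l generalizing k l
  · exact this l k hne.symm hkl.symm (lt_of_le_of_ne (not_lt.1 hlt) hne.symm)
  have hlt' : k.val < l.val := hlt
  have hl := l.is_lt
  have hdrop : (w.drop (w.length - l)).drop (l - k) = w.drop (w.length - k) := by
    rw [List.drop_drop]
    congr 1
    omega
  have hsplit : (w.drop (w.length - l)).take (l - k) ++ w.drop (w.length - k) =
      w.drop (w.length - l) := by
    rw [← hdrop, List.take_append_drop]
  refine ⟨w.take (w.length - l), (w.drop (w.length - l)).take (l - k), w.drop (w.length - k),
    ?_, ?_, ?_, ?_⟩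
  · rw [hsplit, List.take_append_drop]
  · rw [← List.length_pos_iff_ne_nil, List.length_take, List.length_drop]
    omega
  · rw [List.length_take, List.length_drop]
    omega
  · rw [hsplit]
    exact hkl.symm

theorem IsLeftCongr.exists_shrink (hF : IsLeftCongr F) (w : List A) (h : s ≤ w.length) :
    ∃ w', F w' = F w ∧ w'.length < w.length ∧ w.length ≤ w'.length + s := by
  obtain ⟨u, v, t, rfl, hv, hvs, h⟩ := exists_repetition (F := F) w h
  refine ⟨u ++ t, (hF.append u h).symm, ?_, ?_⟩
  · have := List.length_pos_iff_ne_nil.2 hv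
    simp only [List.length_append]
    omega
  · simp only [List.length_append]
    omega

/-- Every state is reached by a word shorter than the number of states. -/
theorem IsLeftCongr.exists_short (hF : IsLeftCongr F) (w : List A) :
    ∃ w', F w' = F w ∧ w'.length < s := by
  induction hn : w.length using Nat.strong_induction_on generalizing w with
  | _ n ih =>
    by_cases h : s ≤ w.length
    · obtain ⟨w', h1, h2, -⟩ := hF.exists_shrink w h
      obtain ⟨w'', h3, h4⟩ := ih w'.length (hn ▸ h2) w' rfl
      exact ⟨w'', h3.trans h1, h4⟩
    · exact ⟨w, rfl, by omega⟩

theorem IsLeftCongr.infinite_of_long (hF : IsLeftCongr F) {Y : Set (List A)}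
    (hY : ∀ y y', F y = F y' → y ∈ Y → y' ∈ Y) {w : List A} (hw : w ∈ Y) (h : s ≤ w.length) :
    Y.Infinite := by
  obtain ⟨u, v, t, rfl, hv, -, h⟩ := exists_repetition (F := F) w h
  have hpos := List.length_pos_iff_ne_nil.2 hv
  have hpump : ∀ k : ℕ, F ((List.replicate k v).flatten ++ t) = F t := by
    intro k
    induction k with
    | zero => simp
    | succ k ih =>
      rw [List.replicate_succ, List.flatten_cons, List.append_assoc]
      exact (hF.append v ih).trans h
  refine Set.infinite_of_injective_forall_mem
    (f := fun k : ℕ => u ++ ((List.replicate k v).flatten ++ t)) ?_ ?_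
  · intro k l hkl
    have := congrArg List.length hkl
    simp only [List.length_append, List.length_flatten, List.map_replicate,
      List.sum_replicate, smul_eq_mul] at this
    exact Nat.eq_of_mul_eq_mul_right hpos (by omega)
  · intro k
    exact hY _ _ (hF.append u (h.trans (hpump k).symm)) hw

theorem IsLeftCongr.exists_of_infinite [Finite A] (hF : IsLeftCongr F) {Y : Set (List A)}
    (hY : ∀ y y', F y = F y' → y ∈ Y → y' ∈ Y) (hinf : Y.Infinite) :
    ∃ y ∈ Y, s ≤ y.length ∧ y.length ≤ 2 * s := by
  obtain ⟨y, hy, hlong⟩ : ∃ y ∈ Y, s ≤ y.length := by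
    by_contra! hcon
    exact hinf ((List.finite_length_lt A s).subset hcon)
  induction hn : y.length using Nat.strong_induction_on generalizing y with
  | _ n ih =>
    by_cases h : y.length ≤ 2 * s
    · exact ⟨y, hy, hlong, h⟩
    · obtain ⟨w', h1, h2, h3⟩ := hF.exists_shrink y hlong
      exact ih w'.length (hn ▸ h2) w' (hY _ _ h1.symm hy) (by omega) rfl

/-- The number of words in a recognized set can be read off from its words of length at most
`2 * s`. -/
theorem IsLeftCongr.encard_eq [Finite A] (hF : IsLeftCongr F) {Y : Set (List A)}
    (hY : ∀ y y', F y = F y' → y ∈ Y → y' ∈ Y) {l : List (List A)} (hl : l.Nodup)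
    (hmem : ∀ y, y ∈ l ↔ y.length ≤ 2 * s ∧ y ∈ Y) :
    Y.encard = if ∃ y ∈ l, s ≤ y.length then (⊤ : ℕ∞) else l.length := by
  classical
  split_ifs with h
  · obtain ⟨y, hy, hs⟩ := h
    exact Set.encard_eq_top (hF.infinite_of_long hY ((hmem y).1 hy).2 hs)
  · have hYl : Y = (l.toFinset : Set (List A)) := by
      ext y
      simp only [List.coe_toFinset, Set.mem_ofPred_eq, hmem]
      refine ⟨fun hy => ⟨?_, hy⟩, fun hy => hy.2⟩
      by_contra hlong
      obtain ⟨y', h1, h2, h3⟩ := hF.exists_of_infinite hY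
        (hF.infinite_of_long hY hy (by omega))
      exact h ⟨y', (hmem y').2 ⟨h3, h1⟩, h2⟩
    rw [hYl, Set.encard_coe_eq_coe_finsetCard, List.toFinset_card_of_nodup hl]

/-- The number of states that suffice to recognize `{y | P x y}` for a fixed word `x` of length
`l`, if `P` is recognized with `N` states. -/
def sectionBound (N l : ℕ) : ℕ := N * (2 ^ (l + 1) * (2 ^ (l + 1) * (l + 3)))

theorem sectionBound_mono {N l l' : ℕ} (h : l ≤ l') : sectionBound N l ≤ sectionBound N l' := by
  unfold sectionBound
  gcongr <;> omega

/-- Apart from the state of `y`, it suffices to know which suffixes of `x` are subwords of `y`, which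
suffixes of `x` are superwords of `y`, and the length of `y` up to `x.length + 2`. -/
theorem Recognized.exists_section {N : ℕ} {P : List A → List A → Prop} (h : Recognized N P)
    (x : List A) {s : ℕ} (hs : sectionBound N x.length ≤ s) :
    ∃ F : List A → Fin s, IsLeftCongr F ∧ ∀ y y', F y = F y' → P x y → P x y' := by
  classical
  obtain ⟨F, hF, h⟩ := h
  let G : List A → Fin N × (Set (Fin (x.length + 1)) × (Set (Fin (x.length + 1)) ×
      Fin (x.length + 3))) := fun y => (F y, {k | x.drop k <+ y}, {k | y <+ x.drop k},
        ⟨min y.length (x.length + 2), by omega⟩)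
  have hG : ∀ y y', G y = G y' ↔ F y = F y' ∧ (∀ t, t <:+ x → (t <+ y ↔ t <+ y')) ∧
      (∀ t, t <:+ x → (y <+ t ↔ y' <+ t)) ∧
      min y.length (x.length + 2) = min y'.length (x.length + 2) := by
    intro y y'
    have hsuf : ∀ p : List A → Prop,
        (∀ t, t <:+ x → p t) ↔ ∀ k : Fin (x.length + 1), p (x.drop k) := by
      intro p
      refine ⟨fun H k => H _ (List.drop_suffix _ _), fun H t ht => ?_⟩
      rw [List.suffix_iff_eq_drop.1 ht]
      exact H ⟨x.length - t.length, by omega⟩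
    rw [hsuf, hsuf]
    simp only [G, Prod.mk.injEq, Set.ext_iff, Set.mem_ofPred_eq, Fin.mk.injEq]
  have hcard : Fintype.card (Fin N × (Set (Fin (x.length + 1)) × (Set (Fin (x.length + 1)) ×
      Fin (x.length + 3)))) ≤ s := by
    refine le_trans (le_of_eq ?_) hs
    simp [sectionBound]
  obtain ⟨e, he⟩ := exists_injective_fin hcard
  have hGc : IsLeftCongr G := by
    intro b u v huv
    rw [hG] at huv ⊢
    obtain ⟨h1, h2, h3, h4⟩ := huv
    refine ⟨hF b u v h1, ?_, ?_, ?_⟩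
    · intro t ht
      cases t with
      | nil => simp
      | cons c t =>
        rw [List.cons_sublist_cons', List.cons_sublist_cons', h2 _ ht,
          h2 t ((List.suffix_cons c t).trans ht)]
    · intro t
      induction t with
      | nil => simp
      | cons c t ih =>
        intro ht
        have ht' := (List.suffix_cons c t).trans ht
        rw [List.cons_sublist_cons', List.cons_sublist_cons', ih ht', h3 t ht']
    · simp only [List.length_cons]
      omega
  refine ⟨e ∘ G, hGc.comp he, fun y y' hy => ?_⟩
  obtain ⟨h1, h2, h3, h4⟩ := (hG y y').1 (he hy)
  have hx1 := h2 x (List.suffix_refl x)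
  have hx2 := h3 x (List.suffix_refl x)
  refine h x y x y' rfl h1 ⟨hx1, hx2, ?_, ?_⟩
  · rw [cover_iff, cover_iff, hx1]
    refine and_congr_right fun _ => ?_
    omega
  · rw [cover_iff, cover_iff, hx2]
    refine and_congr_right fun _ => ?_
    omega

end Pumping

/-! ### The number of states for a formula -/

section Formulas

open scoped List

variable {A : Type u}

/-- The list of states from which `w` is accepted, computed by reading `w` from right to left. -/
def AutomatonCode.backward [DecidableEq A] (M : AutomatonCode A) (w : List A) : List ℕ :=
  w.foldr (fun a l => (M.2.1.filter fun t => t.2.1 = a ∧ t.2.2 ∈ l).map Prod.fst) M.2.2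

theorem AutomatonCode.mem_backward_cons [DecidableEq A] (M : AutomatonCode A) (a : A)
    (w : List A) (i : ℕ) :
    i ∈ M.backward (a :: w) ↔ ∃ j, (i, a, j) ∈ M.2.1 ∧ j ∈ M.backward w := by
  simp only [backward, List.foldr_cons, List.mem_map, List.mem_filter, decide_eq_true_eq,
    Prod.exists]
  constructor
  · rintro ⟨i', a', j, ⟨h, rfl, hj⟩, rfl⟩
    exact ⟨j, h, hj⟩
  · rintro ⟨j, h, hj⟩
    exact ⟨i, a, j, ⟨h, rfl, hj⟩, rfl⟩

theorem AutomatonCode.mem_backward_iff [DecidableEq A] (M : AutomatonCode A) (w : List A) (i : ℕ) :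
    i ∈ M.backward w ↔ w ∈ M.toNFA.acceptsFrom {i} := by
  induction w generalizing i with
  | nil => simp [backward, toNFA]
  | cons a w ih =>
    rw [mem_backward_cons, NFA.cons_mem_acceptsFrom, NFA.stepSet_singleton]
    simp only [ih, NFA.mem_acceptsFrom]
    constructor
    · rintro ⟨j, hj, s, hs, hs'⟩
      exact ⟨s, hs, NFA.mem_evalFrom_iff_exists.2 ⟨j, hj, hs'⟩⟩
    · rintro ⟨s, hs, hs'⟩
      obtain ⟨j, hj, hs'⟩ := NFA.mem_evalFrom_iff_exists.1 hs'
      exact ⟨j, hj, s, hs, hs'⟩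

theorem AutomatonCode.mem_language_iff [DecidableEq A] (M : AutomatonCode A) (w : List A) :
    w ∈ M.language ↔ ∃ i ∈ M.1, i ∈ M.backward w := by
  simp only [mem_backward_iff]
  change w ∈ M.toNFA.acceptsFrom M.toNFA.start ↔ _
  simp only [NFA.mem_acceptsFrom]
  constructor
  · rintro ⟨s, hs, hs'⟩
    obtain ⟨j, hj, hs'⟩ := NFA.mem_evalFrom_iff_exists.1 hs'
    exact ⟨j, hj, s, hs, hs'⟩
  · rintro ⟨j, hj, s, hs, hs'⟩
    exact ⟨s, hs, NFA.mem_evalFrom_iff_exists.2 ⟨j, hj, hs'⟩⟩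

theorem encode_le_encode_of_mem {α : Type*} [Encodable α] {a : α} {l : List α} (h : a ∈ l) :
    Encodable.encode a ≤ Encodable.encode l := by
  induction l with
  | nil => simp at h
  | cons b l ih =>
    rw [Encodable.encode_list_cons]
    obtain rfl | h := List.mem_cons.1 h
    · exact (Nat.left_le_pair _ _).trans (Nat.le_succ _)
    · exact (ih h).trans ((Nat.right_le_pair _ _).trans (Nat.le_succ _))

theorem AutomatonCode.le_encode_of_mem_backward [Encodable A] [DecidableEq A]
    (M : AutomatonCode A) (w : List A) (i : ℕ) (h : i ∈ M.backward w) :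
    i ≤ Encodable.encode M := by
  obtain ⟨I, T, E⟩ := M
  rw [Encodable.encode_prod_val, Encodable.encode_prod_val]
  refine le_trans ?_ (Nat.right_le_pair _ _)
  cases w with
  | nil => exact (encode_le_encode_of_mem (a := i) h).trans (Nat.right_le_pair _ _)
  | cons a w =>
    obtain ⟨j, hj, -⟩ := (mem_backward_cons _ a w i).1 h
    refine le_trans ?_ ((encode_le_encode_of_mem hj).trans (Nat.left_le_pair _ _))
    rw [Encodable.encode_prod_val]
    exact Nat.left_le_pair _ _

theorem AutomatonCode.recognized [Encodable A] (M : AutomatonCode A) {n : ℕ}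
    (hn : Encodable.encode M ≤ n) :
    Recognized (2 ^ (n + 1)) fun x (_ : List A) => x ∈ M.language := by
  classical
  refine Recognized.of_fintype (τ := Set (Fin (n + 1))) (by simp)
    (F := fun w => {i | i.val ∈ M.backward w}) ?_ ?_
  · intro a u v huv
    have huv : ∀ i : ℕ, i ∈ M.backward u ↔ i ∈ M.backward v := by
      intro i
      by_cases hi : i < n + 1
      · exact Set.ext_iff.1 huv ⟨i, hi⟩
      · have hout : ∀ w, i ∉ M.backward w := fun w hw => by
          have := M.le_encode_of_mem_backward w i hw
          omega
        simp [hout]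
    ext i
    simp only [Set.mem_ofPred_eq, M.mem_backward_cons, huv]
  · intro x _ x' _ hx _ _ hM
    rw [M.mem_language_iff] at hM ⊢
    obtain ⟨i, hi, hi'⟩ := hM
    have hlt := M.le_encode_of_mem_backward x i hi'
    exact ⟨i, hi, (Set.ext_iff.1 hx ⟨i, by omega⟩).1 hi'⟩

/-- `stateBound c n` states suffice for every formula whose code is below `n`; here `c` is the
cardinality of `Branch A`. The summands of the recursion are for automata, conjunction, negation
and quantifiers, respectively. -/
def stateBound (c : ℕ) (n : ℕ) : ℕ :=
  Nat.rec 1 (fun n N => 2 ^ (n + 1) + (N * N + (N + N * (n + 3) ^ (c * N)))) n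

theorem two_pow_le_stateBound (c n : ℕ) : 2 ^ (n + 1) ≤ stateBound c (n + 1) :=
  Nat.le_add_right _ _

theorem mul_self_le_stateBound (c n : ℕ) :
    stateBound c n * stateBound c n ≤ stateBound c (n + 1) :=
  (Nat.le_add_right _ _).trans (Nat.le_add_left _ _)

theorem stateBound_le_succ (c n : ℕ) : stateBound c n ≤ stateBound c (n + 1) :=
  (Nat.le_add_right _ _).trans ((Nat.le_add_left _ _).trans (Nat.le_add_left _ _))

theorem mul_pow_le_stateBound (c n : ℕ) :
    stateBound c n * (n + 3) ^ (c * stateBound c n) ≤ stateBound c (n + 1) :=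
  (Nat.le_add_left _ _).trans ((Nat.le_add_left _ _).trans (Nat.le_add_left _ _))

theorem Recognized.of_sameType {P : List A → List A → Prop} {N : ℕ} (hN : 1 ≤ N)
    (h : ∀ x y x' y', SameType x y x' y' → P x y → P x' y') : Recognized N P :=
  Recognized.of_fintype (τ := Unit) (by simpa using hN) (F := fun _ => ()) (fun _ _ _ _ => rfl)
    fun x y x' y' _ _ => h x y x' y'

theorem one_le_stateBound (c n : ℕ) : 1 ≤ stateBound c n := by
  cases n with
  | zero => exact le_rfl
  | succ n => exact Nat.one_le_two_pow.trans (two_pow_le_stateBound c n)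

theorem update_zero (x y w : List A) : Function.update ![x, y] 0 w = ![w, y] := by
  ext i : 1
  fin_cases i <;> rfl

theorem update_one (x y w : List A) : Function.update ![x, y] 1 w = ![x, w] := by
  ext i : 1
  fin_cases i <;> rfl

/-- The numbers `K` and `q` are bounded by `n` in order to have a bound in terms of the code. -/
theorem Recognized.quantifier [Fintype A] {φ : Formula2 A} {N K q n : ℕ}
    (h : Recognized N fun x y => φ.Holds ![x, y]) (hK : 1 ≤ K) (hq : 1 ≤ q) (hn : K + q ≤ n + 2)
    {R : ℕ∞ → Prop} (hR : ∀ a b, Approx K q a b → R a → R b) (z : Fin 2) :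
    Recognized (N * (n + 3) ^ (Fintype.card (Branch A) * N))
      fun x y => R {w | φ.Holds (Function.update ![x, y] z w)}.encard := by
  have hle : N * (K + q + 1) ^ (Fintype.card (Branch A) * N) ≤
      N * (n + 3) ^ (Fintype.card (Branch A) * N) :=
    Nat.mul_le_mul_left _ (Nat.pow_le_pow_left (by omega) _)
  match z with
  | 0 =>
    simp only [update_zero]
    exact ((h.swap.count hK hq hR).mono hle).swap
  | 1 =>
    simp only [update_one]
    exact (h.count hK hq hR).mono hle

/-- Codes of proper subformulas, thresholds and moduli are smaller than the code of the formula, so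
that induction on the formula can follow the recursion of `stateBound`. -/
theorem Recognized.holds [Fintype A] [Encodable A] (φ : Formula2 A) {n : ℕ} (hn : φ.code < n) :
    Recognized (stateBound (Fintype.card (Branch A)) n) fun x y => φ.Holds ![x, y] := by
  induction φ generalizing n with
  | eq s t =>
    refine Recognized.of_sameType (one_le_stateBound _ _) fun x y x' y' h => ?_
    have h' := h.eq_iff
    have h'' := h.swap.eq_iff
    fin_cases s <;> fin_cases t <;> simp [Formula.Holds, h', h'']
  | subword s t =>
    refine Recognized.of_sameType (one_le_stateBound _ _) fun x y x' y' h => ?_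
    fin_cases s <;> fin_cases t <;> simp [Formula.Holds, Subword, h.1, h.2.1]
  | cover s t =>
    refine Recognized.of_sameType (one_le_stateBound _ _) fun x y x' y' h => ?_
    fin_cases s <;> fin_cases t <;>
      simp [Formula.Holds, h.2.2.1, h.2.2.2, cover_iff (u := x) (w := x),
        cover_iff (u := y) (w := y)]
  | mem t M =>
    cases n with
    | zero => omega
    | succ n =>
      have hM : Encodable.encode M ≤ n := by
        have h1 := Nat.right_le_pair 3 (Nat.pair (Encodable.encode t) (Encodable.encode M))
        have h2 := Nat.right_le_pair (Encodable.encode t) (Encodable.encode M)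
        simp only [Formula.code] at hn
        omega
      have h := (M.recognized hM).mono (two_pow_le_stateBound (Fintype.card (Branch A)) n)
      match t with
      | 0 => exact h
      | 1 => exact h.swap
  | not φ ih =>
    cases n with
    | zero => omega
    | succ n =>
      have hφ : φ.code < n := by
        have := Nat.add_le_pair 4 φ.code
        simp only [Formula.code] at hn
        omega
      exact (ih hφ).not.mono (stateBound_le_succ _ _)
  | and φ ψ ih ih' =>
    cases n with
    | zero => omega
    | succ n =>
      have h1 := Nat.add_le_pair 5 (Nat.pair φ.code ψ.code)
      have h2 := Nat.left_le_pair φ.code ψ.code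
      have h3 := Nat.right_le_pair φ.code ψ.code
      simp only [Formula.code] at hn
      exact ((ih (n := n) (by omega)).and (ih' (n := n) (by omega))).mono
        (mul_self_le_stateBound _ _)
  | ex z φ ih =>
    cases n with
    | zero => omega
    | succ n =>
      have h1 := Nat.add_le_pair 6 (Nat.pair (Encodable.encode z) φ.code)
      have h2 := Nat.right_le_pair (Encodable.encode z) φ.code
      simp only [Formula.code] at hn
      have h := (ih (n := n) (by omega)).quantifier (K := 1) (q := 1) (n := n) le_rfl le_rfl
        (by omega) (R := fun a => ((1 : ℕ) : ℕ∞) ≤ a) (fun a b hab => hab.le_iff.1) z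
      refine Recognized.mono ?_ (mul_pow_le_stateBound _ n)
      simpa only [Formula.Holds, Nat.cast_one, Set.one_le_encard_iff_nonempty, Set.Nonempty,
        Set.mem_ofPred_eq] using h
  | exAtLeast k z φ ih =>
    cases n with
    | zero => omega
    | succ n =>
      have h1 := Nat.add_le_pair 7 (Nat.pair k (Nat.pair (Encodable.encode z) φ.code))
      have h2 := Nat.add_le_pair k (Nat.pair (Encodable.encode z) φ.code)
      have h3 := Nat.right_le_pair (Encodable.encode z) φ.code
      simp only [Formula.code] at hn
      refine Recognized.mono ((ih (n := n) (by omega)).quantifier (K := max 1 k) (q := 1)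
        (n := n) (le_max_left _ _) le_rfl (by omega) (R := fun a => (k : ℕ∞) ≤ a) ?_ z)
        (mul_pow_le_stateBound _ n)
      intro a b hab ha
      obtain rfl | ⟨m, n, rfl, rfl, -, hn, -⟩ := hab
      · exact ha
      · exact_mod_cast (le_max_right 1 k).trans hn
  | exMod p q hpq z φ ih =>
    cases n with
    | zero => omega
    | succ n =>
      have h1 := Nat.add_le_pair 8 (Nat.pair p (Nat.pair q (Nat.pair (Encodable.encode z) φ.code)))
      have h2 := Nat.right_le_pair p (Nat.pair q (Nat.pair (Encodable.encode z) φ.code))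
      have h3 := Nat.add_le_pair q (Nat.pair (Encodable.encode z) φ.code)
      have h4 := Nat.right_le_pair (Encodable.encode z) φ.code
      simp only [Formula.code] at hn
      exact Recognized.mono ((ih (n := n) (by omega)).quantifier (K := 1) (q := q)
        (n := n) le_rfl (by omega) (by omega)
        (R := fun a => ∃ m : ℕ, a = ((p + q * m : ℕ) : ℕ∞))
        (fun a b hab => hab.exists_eq_add_mul hpq) z) (mul_pow_le_stateBound _ n)

end Formulas

/-! ### Evaluation of formulas on words of bounded length -/

section Evaluation

open scoped List

variable {A : Type u}

/-- The words of length at most `n` over the letters in `as`. -/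
def wordsLe (as : List A) (n : ℕ) : List (List A) :=
  Nat.rec [[]] (fun _ l => [] :: l.flatMap fun w => as.map fun a => a :: w) n

theorem mem_wordsLe {as : List A} (has : ∀ a, a ∈ as) {n : ℕ} {w : List A} :
    w ∈ wordsLe as n ↔ w.length ≤ n := by
  induction n generalizing w with
  | zero => simp [wordsLe]
  | succ n ih =>
    change w ∈ [] :: (wordsLe as n).flatMap _ ↔ _
    cases w with
    | nil => simp
    | cons a w => simp [has, ih]

theorem nodup_wordsLe {as : List A} (has : as.Nodup) (n : ℕ) : (wordsLe as n).Nodup := by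
  induction n with
  | zero => simp [wordsLe]
  | succ n ih =>
    change ([] :: (wordsLe as n).flatMap _).Nodup
    rw [List.nodup_cons, List.nodup_flatMap]
    refine ⟨by simp, fun w _ => has.map fun a b h => (List.cons.inj h).1, ?_⟩
    refine ih.imp fun {v w} hne => ?_
    simp only [Function.onFun, List.disjoint_left, List.mem_map]
    rintro _ ⟨a, -, rfl⟩ ⟨b, -, h⟩
    exact hne (List.cons.inj h).2.symm

/-- The value of the variable number `i` under the assignment `![x, y]`. -/
def pick (i : ℕ) (x y : List A) : List A := if i = 0 then x else y

/-- A table of triples: the code of a formula and the two words that are assigned to its variables.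
-/
abbrev Table (A : Type u) : Type u := List (ℕ × List A × List A)

open scoped Classical in
/-- The words of length at most `2 * s` that satisfy the formula with code `m` according to the
table `T`, when they are assigned to the variable number `z`. -/
noncomputable def witnesses (as : List A) (T : Table A) (s m z : ℕ) (x y : List A) :
    List (List A) :=
  (wordsLe as (2 * s)).filter fun w => (m, (if z = 0 then w else x), (if z = 0 then y else w)) ∈ T

/-- The semantics of the outermost connective of the formula with code `m`, where the subformulas
are evaluated by the table `T`. A witness of length at least `s` indicates that there are infinitely
many of them. -/
def Rule [Encodable A] (as : List A) (T : Table A) (s m : ℕ) (x y : List A) : Prop :=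
  let r := m.unpair.2
  (m.unpair.1 = 0 ∧ pick r.unpair.1 x y = pick r.unpair.2 x y) ∨
  (m.unpair.1 = 1 ∧ pick r.unpair.1 x y <+ pick r.unpair.2 x y) ∨
  (m.unpair.1 = 2 ∧ pick r.unpair.1 x y <+ pick r.unpair.2 x y ∧
    (pick r.unpair.2 x y).length = (pick r.unpair.1 x y).length + 1) ∨
  (m.unpair.1 = 3 ∧
    pick r.unpair.1 x y ∈ ((Encodable.decode r.unpair.2).getD ([], [], []) :
      AutomatonCode A).language) ∨
  (m.unpair.1 = 4 ∧ (r, x, y) ∉ T) ∨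
  (m.unpair.1 = 5 ∧ (r.unpair.1, x, y) ∈ T ∧ (r.unpair.2, x, y) ∈ T) ∨
  (m.unpair.1 = 6 ∧ 1 ≤ (witnesses as T s r.unpair.2 r.unpair.1 x y).length) ∨
  (m.unpair.1 = 7 ∧
    ((∃ w ∈ witnesses as T s r.unpair.2.unpair.2 r.unpair.2.unpair.1 x y, s ≤ w.length) ∨
      r.unpair.1 ≤ (witnesses as T s r.unpair.2.unpair.2 r.unpair.2.unpair.1 x y).length)) ∨
  (m.unpair.1 = 8 ∧
    ¬ (∃ w ∈ witnesses as T s r.unpair.2.unpair.2.unpair.2 r.unpair.2.unpair.2.unpair.1 x y,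
      s ≤ w.length) ∧
    (witnesses as T s r.unpair.2.unpair.2.unpair.2 r.unpair.2.unpair.2.unpair.1 x y).length %
      r.unpair.2.unpair.1 = r.unpair.1)

theorem encode_fin_two (z : Fin 2) : Encodable.encode z = z.val := rfl

theorem pick_val (z : Fin 2) (x y : List A) : pick z.val x y = ![x, y] z := by
  fin_cases z <;> rfl

theorem update_fin_two (z : Fin 2) (x y w : List A) : Function.update ![x, y] z w =
    ![if z.val = 0 then w else x, if z.val = 0 then y else w] := by
  match z with
  | 0 => simpa using update_zero x y w
  | 1 => simpa using update_one x y w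

/-- The number of words that satisfy a formula, computed from the witnesses of bounded length. -/
theorem encard_eq_of_witnesses [Finite A] {as : List A} (has : ∀ a, a ∈ as) (has' : as.Nodup)
    {T : Table A} {s N l m : ℕ} {φ : Formula2 A} (hN : Recognized N fun x y => φ.Holds ![x, y])
    (hs : sectionBound N l ≤ s) (hl : l ≤ 2 * s)
    (hT : ∀ x y : List A, x.length ≤ 2 * s → y.length ≤ 2 * s →
      ((m, x, y) ∈ T ↔ φ.Holds ![x, y])) {x y : List A} (hx : x.length ≤ l) (hy : y.length ≤ l)
    (z : Fin 2) :
    {w | φ.Holds (Function.update ![x, y] z w)}.encard =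
      if ∃ w ∈ witnesses as T s m z x y, s ≤ w.length then (⊤ : ℕ∞)
      else (witnesses as T s m z x y).length := by
  have hsec : ∃ F : List A → Fin s, IsLeftCongr F ∧ ∀ w w', F w = F w' →
      φ.Holds (Function.update ![x, y] z w) → φ.Holds (Function.update ![x, y] z w') := by
    match z with
    | 0 =>
      simp only [update_zero]
      exact hN.swap.exists_section y ((sectionBound_mono hy).trans hs)
    | 1 =>
      simp only [update_one]
      exact hN.exists_section x ((sectionBound_mono hx).trans hs)
  obtain ⟨F, hF, hsat⟩ := hsec
  refine hF.encard_eq hsat ((nodup_wordsLe has' _).filter _) fun w => ?_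
  change _ ↔ _ ∧ φ.Holds (Function.update ![x, y] z w)
  simp only [witnesses, List.mem_filter, mem_wordsLe has, decide_eq_true_eq, update_fin_two]
  refine and_congr_right fun hw => hT _ _ ?_ ?_ <;> split_ifs <;> omega

/-- `Rule` is the satisfaction relation, provided that the table is correct for the subformulas. -/
theorem rule_iff [Finite A] [Encodable A] {as : List A} (has : ∀ a, a ∈ as) (has' : as.Nodup)
    {T : Table A} {s N l n : ℕ} (hs : sectionBound N l ≤ s) (hl : l ≤ 2 * s)
    (hN : ∀ φ : Formula2 A, φ.code < n → Recognized N fun x y => φ.Holds ![x, y])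
    (hT : ∀ φ : Formula2 A, φ.code < n → ∀ x y : List A, x.length ≤ 2 * s → y.length ≤ 2 * s →
      ((φ.code, x, y) ∈ T ↔ φ.Holds ![x, y]))
    (φ : Formula2 A) (hφ : φ.code = n) {x y : List A} (hx : x.length ≤ l) (hy : y.length ≤ l) :
    Rule as T s n x y ↔ φ.Holds ![x, y] := by
  subst hφ
  cases φ with
  | eq i j => simp [Rule, Formula.code, Formula.Holds, encode_fin_two, pick_val]
  | subword i j => simp [Rule, Formula.code, Formula.Holds, encode_fin_two, pick_val, Subword]
  | cover i j => simp [Rule, Formula.code, Formula.Holds, encode_fin_two, pick_val, cover_iff]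
  | mem i M => simp [Rule, Formula.code, Formula.Holds, encode_fin_two, pick_val]
  | not φ =>
    have h1 := Nat.add_le_pair 4 φ.code
    have h := hT φ (by simp only [Formula.code]; omega) x y (by omega) (by omega)
    simp [Rule, Formula.code, Formula.Holds, h]
  | and φ ψ =>
    have h1 := Nat.add_le_pair 5 (Nat.pair φ.code ψ.code)
    have h2 := Nat.left_le_pair φ.code ψ.code
    have h3 := Nat.right_le_pair φ.code ψ.code
    have h := hT φ (by simp only [Formula.code]; omega) x y (by omega) (by omega)
    have h' := hT ψ (by simp only [Formula.code]; omega) x y (by omega) (by omega)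
    simp [Rule, Formula.code, Formula.Holds, h, h']
  | ex z φ =>
    have h1 := Nat.add_le_pair 6 (Nat.pair (Encodable.encode z) φ.code)
    have h2 := Nat.right_le_pair (Encodable.encode z) φ.code
    have hlt : φ.code < (Formula.ex z φ).code := by simp only [Formula.code]; omega
    have h := encard_eq_of_witnesses has has' (hN φ hlt) hs hl (hT φ hlt) hx hy z
    have hR : Rule as T s (Formula.ex z φ).code x y ↔
        1 ≤ (witnesses as T s φ.code z x y).length := by
      simp [Rule, Formula.code, encode_fin_two]
    have hH : (Formula.ex z φ).Holds ![x, y] ↔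
        1 ≤ {w | φ.Holds (Function.update ![x, y] z w)}.encard := by
      simp only [Set.one_le_encard_iff_nonempty, Formula.Holds, Set.Nonempty, Set.mem_ofPred_eq]
    rw [hR, hH, h]
    split_ifs with hw
    · obtain ⟨w, hw, -⟩ := hw
      exact iff_of_true (List.length_pos_of_mem hw) le_top
    · exact_mod_cast Iff.rfl
  | exAtLeast k z φ =>
    have h1 := Nat.add_le_pair 7 (Nat.pair k (Nat.pair (Encodable.encode z) φ.code))
    have h2 := Nat.right_le_pair k (Nat.pair (Encodable.encode z) φ.code)
    have h3 := Nat.right_le_pair (Encodable.encode z) φ.code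
    have hlt : φ.code < (Formula.exAtLeast k z φ).code := by simp only [Formula.code]; omega
    have h := encard_eq_of_witnesses has has' (hN φ hlt) hs hl (hT φ hlt) hx hy z
    have hR : Rule as T s (Formula.exAtLeast k z φ).code x y ↔
        (∃ w ∈ witnesses as T s φ.code z x y, s ≤ w.length) ∨
          k ≤ (witnesses as T s φ.code z x y).length := by
      simp [Rule, Formula.code, encode_fin_two]
    rw [hR, Formula.Holds, h]
    split_ifs with hw
    · simp only [hw, true_or, le_top]
    · simp only [hw, false_or, Nat.cast_le]
  | exMod p q hpq z φ =>
    have h1 := Nat.add_le_pair 8 (Nat.pair p (Nat.pair q (Nat.pair (Encodable.encode z) φ.code)))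
    have h2 := Nat.right_le_pair p (Nat.pair q (Nat.pair (Encodable.encode z) φ.code))
    have h3 := Nat.right_le_pair q (Nat.pair (Encodable.encode z) φ.code)
    have h4 := Nat.right_le_pair (Encodable.encode z) φ.code
    have hlt : φ.code < (Formula.exMod p q hpq z φ).code := by simp only [Formula.code]; omega
    have h := encard_eq_of_witnesses has has' (hN φ hlt) hs hl (hT φ hlt) hx hy z
    have hR : Rule as T s (Formula.exMod p q hpq z φ).code x y ↔
        ¬ (∃ w ∈ witnesses as T s φ.code z x y, s ≤ w.length) ∧
          (witnesses as T s φ.code z x y).length % q = p := by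
      simp [Rule, Formula.code, encode_fin_two]
    rw [hR, Formula.Holds, h]
    split_ifs with hw
    · simp only [hw, not_true_eq_false, false_and, false_iff, not_exists]
      exact fun m => (ENat.natCast_ne_top _).symm
    · simp only [hw, not_false_eq_true, true_and, Nat.cast_inj]
      constructor
      · rintro h
        exact ⟨_, by rw [← h]; exact (Nat.mod_add_div _ _).symm⟩
      · rintro ⟨m, hm⟩
        rw [hm, Nat.add_mul_mod_self_left, Nat.mod_eq_of_lt hpq]

/-- The lengths of the words on which formulas have to be evaluated, in order to evaluate a formula
with `j` further nested subformulas on words of length at most `l`. -/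
def lengthBound (N l j : ℕ) : ℕ := Nat.rec l (fun _ l => 2 * sectionBound N l) j

theorem le_sectionBound {N : ℕ} (hN : 1 ≤ N) (l : ℕ) : l ≤ sectionBound N l := by
  have h1 : 1 ≤ 2 ^ (l + 1) := Nat.one_le_two_pow
  have h2 : 1 ≤ N * (2 ^ (l + 1) * 2 ^ (l + 1)) :=
    Nat.mul_pos hN (Nat.mul_pos h1 h1)
  calc l ≤ 1 * (l + 3) := by omega
    _ ≤ N * (2 ^ (l + 1) * 2 ^ (l + 1)) * (l + 3) := Nat.mul_le_mul_right _ h2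
    _ = sectionBound N l := by unfold sectionBound; ring

theorem lengthBound_le_succ {N : ℕ} (hN : 1 ≤ N) (l j : ℕ) :
    lengthBound N l j ≤ lengthBound N l (j + 1) :=
  (le_sectionBound hN _).trans (Nat.le_mul_of_pos_left _ two_pos)

open scoped Classical in
/-- Extends the table `T` by the entries for the formula with code `m` and words of length at most
`l`. -/
noncomputable def tableStep [Encodable A] (as : List A) (N l m : ℕ) (T : Table A) : Table A :=
  T ++ ((wordsLe as l).flatMap fun x => (wordsLe as l).map fun y => (m, x, y)).filter
    fun t => Rule as T (sectionBound N l) t.1 t.2.1 t.2.2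

/-- The table for the formulas with codes below `i`. The words get shorter as `i` grows to `K`,
since the entries for a formula require those for its subformulas on longer words. -/
noncomputable def table [Encodable A] (as : List A) (N K l i : ℕ) : Table A :=
  Nat.rec [] (fun i T => tableStep as N (lengthBound N l (K - (i + 1))) i T) i

/-- The first part is needed for the induction: the entries that are added for the code `i` do not
interfere with those of smaller codes. -/
theorem mem_table_iff [Finite A] [Encodable A] {as : List A} (has : ∀ a, a ∈ as)
    (has' : as.Nodup) {N K l : ℕ} (hN1 : 1 ≤ N)
    (hN : ∀ φ : Formula2 A, φ.code < K → Recognized N fun x y => φ.Holds ![x, y]) {i : ℕ}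
    (hi : i ≤ K) :
    (∀ t ∈ table as N K l i, t.1 < i) ∧ ∀ φ : Formula2 A, φ.code < i → ∀ x y : List A,
      x.length ≤ lengthBound N l (K - i) → y.length ≤ lengthBound N l (K - i) →
        ((φ.code, x, y) ∈ table as N K l i ↔ φ.Holds ![x, y]) := by
  induction i with
  | zero => simp [table]
  | succ i ih =>
    obtain ⟨ih1, ih2⟩ := ih (by omega)
    have hK : K - i = K - (i + 1) + 1 := by omega
    have hmem : ∀ t, t ∈ table as N K l (i + 1) ↔ t ∈ table as N K l i ∨
        ((t.1 = i ∧ t.2.1.length ≤ lengthBound N l (K - (i + 1)) ∧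
          t.2.2.length ≤ lengthBound N l (K - (i + 1))) ∧
        Rule as (table as N K l i) (sectionBound N (lengthBound N l (K - (i + 1)))) t.1 t.2.1
          t.2.2) := by
      rintro ⟨m, x, y⟩
      change _ ∈ tableStep as N (lengthBound N l (K - (i + 1))) i (table as N K l i) ↔ _
      simp only [tableStep, List.mem_append, List.mem_filter, List.mem_flatMap, List.mem_map,
        mem_wordsLe has, decide_eq_true_eq, Prod.mk.injEq]
      refine or_congr_right (and_congr_left fun _ => ?_)
      constructor
      · rintro ⟨x', hx', y', hy', rfl, rfl, rfl⟩
        exact ⟨rfl, hx', hy'⟩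
      · rintro ⟨rfl, hx, hy⟩
        exact ⟨x, hx, y, hy, rfl, rfl, rfl⟩
    constructor
    · intro t ht
      rcases (hmem t).1 ht with ht | ht
      · exact (ih1 t ht).trans (Nat.lt_succ_self i)
      · exact ht.1.1 ▸ Nat.lt_succ_self i
    · intro φ hφ x y hx hy
      have hle := lengthBound_le_succ hN1 l (K - (i + 1))
      rw [hmem]
      rcases Nat.lt_succ_iff_lt_or_eq.1 hφ with hlt | rfl
      · rw [← ih2 φ hlt x y (by rw [hK]; omega) (by rw [hK]; omega)]
        exact or_iff_left fun h => hlt.ne h.1.1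
      · rw [or_iff_right fun h => lt_irrefl _ (ih1 _ h)]
        have h := rule_iff has has' (T := table as N K l φ.code) (N := N) le_rfl hle
          (fun ψ hψ => hN ψ (by omega)) (fun ψ hψ x y hx hy => ih2 ψ hψ x y
            (by rw [hK]; exact hx) (by rw [hK]; exact hy)) φ rfl hx hy
        rw [← h]
        exact and_iff_right ⟨rfl, hx, hy⟩

end Evaluation

/-! ### The automaton of a set of words -/

section Output

variable {A : Type u}

/-- The words `u` and `v` cannot be distinguished by a prefix from `U`. -/
def Similar (U S : List (List A)) (u v : List A) : Prop :=
  ∀ t ∈ U, t ++ u ∈ S ↔ t ++ v ∈ S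

open scoped Classical in
/-- The automaton whose states are the words of length at most `n`, for a set of words that is given
by its list `S` of elements of bounded length. From the state `v`, it accepts the words that are
equivalent to `v` for the syntactic left congruence. -/
noncomputable def syntacticAutomaton [Encodable A] (as : List A) (n k : ℕ) (S : List (List A)) :
    AutomatonCode A :=
  (((wordsLe as n).filter (· ∈ S)).map Encodable.encode,
    (wordsLe as n).flatMap fun v => as.flatMap fun a =>
      ((wordsLe as n).filter fun u => Similar (wordsLe as k) S v (a :: u)).map fun u =>
        (Encodable.encode v, a, Encodable.encode u),
    ((wordsLe as n).filter fun v => Similar (wordsLe as k) S v []).map Encodable.encode)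

/-- The automaton accepts `L`, if `N` states suffice for `L` and `S` is correct on the words needed
for the comparison of states. -/
theorem syntacticAutomaton_language [Encodable A] {as : List A} (has : ∀ a, a ∈ as) {N : ℕ}
    {F : List A → Fin N} (hF : IsLeftCongr F) {L : Set (List A)}
    (hL : ∀ u v, F u = F v → u ∈ L → v ∈ L) {S : List (List A)}
    (hS : ∀ w : List A, w.length ≤ N * N + N + 1 → (w ∈ S ↔ w ∈ L)) :
    (syntacticAutomaton as N (N * N) S).language = L := by
  classical
  let E : List A → List A → Prop := fun u v => ∀ t, t ++ u ∈ L ↔ t ++ v ∈ L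
  have hFE : ∀ {u v}, F u = F v → E u v := fun h t =>
    ⟨hL _ _ (hF.append t h), hL _ _ (hF.append t h.symm)⟩
  -- two words that are not equivalent are distinguished by a short prefix, since the pair of
  -- states reached from both words runs through at most `N * N` values
  have hsim : ∀ u v : List A, u.length ≤ N + 1 → v.length ≤ N + 1 →
      (Similar (wordsLe as (N * N)) S u v ↔ E u v) := by
    intro u v hu hv
    have htest : ∀ t : List A, t.length ≤ N * N → ((t ++ u ∈ S ↔ t ++ v ∈ S) ↔
        (t ++ u ∈ L ↔ t ++ v ∈ L)) := by
      intro t ht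
      rw [hS _ (by rw [List.length_append]; omega), hS _ (by rw [List.length_append]; omega)]
    constructor
    · intro h t
      obtain ⟨e, he⟩ := exists_injective_fin (τ := Fin N × Fin N) (N := N * N) (by simp)
      have hG : IsLeftCongr (e ∘ fun t => (F (t ++ u), F (t ++ v))) := by
        refine IsLeftCongr.comp (fun a w w' h => ?_) he
        simp only [Prod.mk.injEq] at h
        exact Prod.ext (hF a _ _ h.1) (hF a _ _ h.2)
      obtain ⟨t', h1, h2⟩ := hG.exists_short t
      have h3 := he h1
      simp only [Prod.mk.injEq] at h3
      have h4 := (htest t' h2.le).1 (h t' ((mem_wordsLe has).2 h2.le))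
      have h5 : ∀ {w w'}, F w = F w' → (w ∈ L ↔ w' ∈ L) := fun h => ⟨hL _ _ h, hL _ _ h.symm⟩
      rw [← h5 h3.1, ← h5 h3.2, h4]
    · exact fun h t ht => (htest t ((mem_wordsLe has).1 ht)).2 (h t)
  set M := syntacticAutomaton as N (N * N) S with hM
  have hback : ∀ (w v : List A), v.length ≤ N → (Encodable.encode v ∈ M.backward w ↔ E v w) := by
    intro w
    induction w with
    | nil =>
      intro v hv
      rw [← hsim v [] (by omega) (by simp)]
      simp [hM, AutomatonCode.backward, syntacticAutomaton, mem_wordsLe has, hv]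
    | cons a w ih =>
      intro v hv
      rw [AutomatonCode.mem_backward_cons]
      constructor
      · rintro ⟨j, hj, hj'⟩
        simp only [hM, syntacticAutomaton, List.mem_flatMap, List.mem_map, List.mem_filter,
          mem_wordsLe has, decide_eq_true_eq, Prod.mk.injEq] at hj
        obtain ⟨v', -, a', -, u, ⟨hu, hsim'⟩, hv', rfl, rfl⟩ := hj
        obtain rfl := Encodable.encode_injective hv'
        have h1 := (hsim v' (a' :: u) (by omega) (by simpa using hu)).1 hsim'
        have h2 := (ih u hu).1 hj'
        intro t
        rw [h1 t]
        simpa using h2 (t ++ [a'])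
      · intro h
        obtain ⟨u, hu, hlen⟩ := hF.exists_short w
        refine ⟨Encodable.encode u, ?_, (ih u hlen.le).2 (hFE hu)⟩
        simp only [hM, syntacticAutomaton, List.mem_flatMap, List.mem_map, List.mem_filter,
          mem_wordsLe has, decide_eq_true_eq, Prod.mk.injEq]
        refine ⟨v, hv, a, has a, u, ⟨hlen.le, ?_⟩, rfl, rfl, rfl⟩
        rw [hsim v (a :: u) (by omega) (by simpa using hlen.le)]
        exact fun t => (h t).trans (hFE (hF a _ _ hu.symm) t)
  ext w
  rw [AutomatonCode.mem_language_iff]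
  simp only [hM, syntacticAutomaton, List.mem_map, List.mem_filter, mem_wordsLe has,
    decide_eq_true_eq]
  rw [← syntacticAutomaton, ← hM]
  constructor
  · rintro ⟨_, ⟨v, ⟨hv, hvS⟩, rfl⟩, hb⟩
    have h1 := ((hback w v hv).1 hb []).1
    exact h1 ((hS v (by omega)).1 hvS)
  · intro hw
    obtain ⟨v, hv, hlen⟩ := hF.exists_short w
    refine ⟨_, ⟨v, ⟨hlen.le, ?_⟩, rfl⟩, (hback w v hlen.le).2 (hFE hv)⟩
    rw [hS v (by omega)]
    exact hL _ _ hv.symm hw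

theorem Formula.holds_congr {V : Type*} [DecidableEq V] (φ : Formula A V) {s s' : V → List A}
    (h : ∀ v ∈ φ.freeVars, s v = s' v) : φ.Holds s ↔ φ.Holds s' := by
  have hupd : ∀ {S : Set V} {z : V} {s s' : V → List A}, (∀ v ∈ S \ {z}, s v = s' v) →
      ∀ w, ∀ v ∈ S, Function.update s z w v = Function.update s' z w v := by
    intro S z s s' h w v hv
    by_cases hz : v = z
    · subst hz; simp
    · simp [hz, h v ⟨hv, hz⟩]
  induction φ generalizing s s' with
  | eq i j => simp [Holds, h i (Or.inl rfl), h j (Or.inr rfl)]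
  | subword i j => simp [Holds, h i (Or.inl rfl), h j (Or.inr rfl)]
  | cover i j => simp [Holds, h i (Or.inl rfl), h j (Or.inr rfl)]
  | mem i M => simp [Holds, h i rfl]
  | not φ ih => simp only [Holds, ih h]
  | and φ ψ ih ih' =>
    simp only [Holds, ih fun v hv => h v (Or.inl hv), ih' fun v hv => h v (Or.inr hv)]
  | ex z φ ih => simp only [Holds, fun w => ih (hupd h w)]
  | exAtLeast k z φ ih => simp only [Holds, fun w => ih (hupd h w)]
  | exMod p q hpq z φ ih => simp only [Holds, fun w => ih (hupd h w)]

theorem Formula.definedSet_eq {φ : Formula2 A} {x : Fin 2} (h : φ.freeVars ⊆ {x}) :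
    φ.definedSet x = {w | φ.Holds ![w, w]} := by
  ext w
  have hx : ![w, w] x = w := by fin_cases x <;> rfl
  constructor
  · exact fun hw => hw _ hx
  · intro hw s hs
    refine (φ.holds_congr fun v hv => ?_).1 hw
    rw [h hv, hx, hs]

open scoped Classical in
/-- The automaton for the formula with code `n`; here `c` is the cardinality of `Branch A`. Both
variables are assigned the same word, as only one of them matters. -/
noncomputable def formulaAutomaton [Encodable A] (as : List A) (c n : ℕ) : AutomatonCode A :=
  let N := stateBound c (n + 1)
  syntacticAutomaton as N (N * N) ((wordsLe as (N * N + N + 1)).filter fun w =>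
    (n, w, w) ∈ table as N (n + 1) (N * N + N + 1) (n + 1))

theorem formulaAutomaton_language [Fintype A] [Encodable A] {as : List A} (has : ∀ a, a ∈ as)
    (has' : as.Nodup) {φ : Formula2 A} {x : Fin 2} (h : φ.freeVars ⊆ {x}) :
    (formulaAutomaton as (Fintype.card (Branch A)) φ.code).language = φ.definedSet x := by
  rw [Formula.definedSet_eq h]
  obtain ⟨F, hF, hP⟩ := Recognized.holds φ (Nat.lt_succ_self φ.code)
  refine syntacticAutomaton_language has hF (fun u v huv => ?_) fun w hw => ?_
  · refine hP u u v v huv huv ⟨?_, ?_, ?_, ?_⟩ <;> simp [cover_iff]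
  · have htab := (mem_table_iff has has' (l := stateBound (Fintype.card (Branch A)) (φ.code + 1) *
      stateBound (Fintype.card (Branch A)) (φ.code + 1) +
      stateBound (Fintype.card (Branch A)) (φ.code + 1) + 1) (one_le_stateBound _ (φ.code + 1))
      (fun ψ hψ => Recognized.holds ψ hψ) le_rfl).2 φ (Nat.lt_succ_self _) w w
      (by simpa [lengthBound] using hw) (by simpa [lengthBound] using hw)
    simp only [List.mem_filter, mem_wordsLe has, decide_eq_true_eq]
    rw [and_iff_right hw]
    exact htab

end Output

/-! ### Computability -/

section Computability

open scoped List

/-- The greedy embedding decides the subword order. -/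
theorem sublist_iff_foldl {A : Type*} [DecidableEq A] (x y : List A) :
    x <+ y ↔ y.foldl (fun r b => if r.head? = some b then r.tail else r) x = [] := by
  induction y generalizing x with
  | nil => simp
  | cons b y ih =>
    rw [List.foldl_cons, ← ih]
    cases x with
    | nil => simp
    | cons a x =>
      by_cases h : a = b
      · subst h
        simp
      · rw [cons_sublist_iff_of_ne h]
        simp [h]

variable {A γ : Type*} [Primcodable A] [Primcodable γ]

theorem primrec_filter {β : Type*} [Primcodable β] {l : γ → List β} {R : β → γ → Prop}
    [DecidableRel R] (hl : Primrec l) (hR : PrimrecPred fun p : β × γ => R p.1 p.2) :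
    Primrec fun c => (l c).filter fun b => R b c :=
  (PrimrecRel.listFilter hR.primrecRel).comp hl Primrec.id

theorem primrecRel_mem {α : Type*} [Primcodable α] :
    PrimrecRel fun (a : α) (l : List α) => a ∈ l :=
  (PrimrecRel.exists_mem_list (Primrec.eq (α := α))).swap.of_eq fun a l => by simp

theorem primrec_wordsLe (as : List A) : Primrec (wordsLe as) := by
  refine Primrec.nat_rec₁ _ (f := fun _ l => [] :: l.flatMap fun w => as.map fun a => a :: w) ?_
  refine Primrec.list_cons.comp (Primrec.const []) (Primrec.list_flatMap Primrec.snd ?_)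
  exact Primrec.list_map (Primrec.const as)
    (Primrec.list_cons.comp Primrec.snd (Primrec.snd.comp Primrec.fst))

theorem primrecRel_sublist : PrimrecRel fun x y : List A => x <+ y := by
  classical
  refine PrimrecRel.of_eq ?_ fun x y => (sublist_iff_foldl x y).symm
  refine Primrec.eq.comp (Primrec.list_foldl Primrec.snd Primrec.fst
    (h := fun _ (p : List A × A) => if p.1.head? = some p.2 then p.1.tail else p.1) ?_)
    (Primrec.const [])
  have hr : Primrec fun p : (List A × List A) × (List A × A) => p.2.1 :=
    Primrec.fst.comp Primrec.snd
  exact Primrec.ite (Primrec.eq.comp (Primrec.list_head?.comp hr)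
    (Primrec.option_some.comp (Primrec.snd.comp Primrec.snd))) (Primrec.list_tail.comp hr) hr

theorem primrec_pick {i : γ → ℕ} {x y : γ → List A} (hi : Primrec i) (hx : Primrec x)
    (hy : Primrec y) : Primrec fun c => pick (i c) (x c) (y c) :=
  Primrec.ite (Primrec.eq.comp hi (Primrec.const 0)) hx hy

theorem primrec_backward [DecidableEq A] :
    Primrec₂ fun (M : AutomatonCode A) (w : List A) => M.backward w := by
  unfold AutomatonCode.backward
  change Primrec fun p : AutomatonCode A × List A => _
  refine Primrec.list_foldr (h := fun (p : AutomatonCode A × List A) (q : A × List ℕ) =>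
    (p.1.2.1.filter fun t => t.2.1 = q.1 ∧ t.2.2 ∈ q.2).map Prod.fst) Primrec.snd
    (Primrec.snd.comp (Primrec.snd.comp Primrec.fst)) ?_
  refine Primrec.list_map (primrec_filter
    (R := fun (t : ℕ × A × ℕ) (p : (AutomatonCode A × List A) × (A × List ℕ)) =>
      t.2.1 = p.2.1 ∧ t.2.2 ∈ p.2.2) ?_ ?_) (Primrec.fst.comp Primrec.snd)
  · exact Primrec.fst.comp (Primrec.snd.comp (Primrec.fst.comp Primrec.fst))
  · have ht : Primrec fun q : (ℕ × A × ℕ) × ((AutomatonCode A × List A) × (A × List ℕ)) =>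
        q.1.2 := Primrec.snd.comp Primrec.fst
    have hp : Primrec fun q : (ℕ × A × ℕ) × ((AutomatonCode A × List A) × (A × List ℕ)) =>
        q.2.2 := Primrec.snd.comp Primrec.snd
    exact (Primrec.eq.comp (Primrec.fst.comp ht) (Primrec.fst.comp hp)).and
      (primrecRel_mem.comp (Primrec.snd.comp ht) (Primrec.snd.comp hp))

theorem primrecRel_language :
    PrimrecRel fun (w : List A) (M : AutomatonCode A) => w ∈ M.language := by
  classical
  have h : PrimrecRel fun (l l' : List ℕ) => ∃ i ∈ l, i ∈ l' :=
    PrimrecRel.exists_mem_list primrecRel_mem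
  refine PrimrecRel.of_eq ?_ fun w M => (M.mem_language_iff w).symm
  exact h.comp (Primrec.fst.comp Primrec.snd) (primrec_backward.comp Primrec.snd Primrec.fst)

theorem primrec_witnesses (as : List A) {T : γ → Table A} {s m z : γ → ℕ} {x y : γ → List A}
    (hT : Primrec T) (hs : Primrec s) (hm : Primrec m) (hz : Primrec z) (hx : Primrec x)
    (hy : Primrec y) :
    Primrec fun c => witnesses as (T c) (s c) (m c) (z c) (x c) (y c) := by
  classical
  refine primrec_filter (R := fun w c => (m c, (if z c = 0 then w else x c),
    (if z c = 0 then y c else w)) ∈ T c)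
    ((primrec_wordsLe as).comp (Primrec.nat_mul.comp (Primrec.const 2) hs)) ?_
  have hz' : PrimrecPred fun p : List A × γ => z p.2 = 0 :=
    Primrec.eq.comp (hz.comp Primrec.snd) (Primrec.const 0)
  exact primrecRel_mem.comp (Primrec.pair (hm.comp Primrec.snd) (Primrec.pair
    (Primrec.ite hz' Primrec.fst (hx.comp Primrec.snd))
    (Primrec.ite hz' (hy.comp Primrec.snd) Primrec.fst))) (hT.comp Primrec.snd)

theorem primrecPred_exists_long {l : γ → List (List A)} {s : γ → ℕ} (hl : Primrec l)
    (hs : Primrec s) : PrimrecPred fun c => ∃ w ∈ l c, s c ≤ w.length := by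
  have h : PrimrecRel fun (l : List (List A)) (s : ℕ) => ∃ w ∈ l, s ≤ w.length :=
    PrimrecRel.exists_mem_list
      (Primrec.nat_le.comp Primrec.snd (Primrec.list_length.comp Primrec.fst))
  exact h.comp hl hs

theorem primrecPred_rule (as : List A) {T : γ → Table A} {s m : γ → ℕ} {x y : γ → List A}
    (hT : Primrec T) (hs : Primrec s) (hm : Primrec m) (hx : Primrec x) (hy : Primrec y) :
    PrimrecPred fun c => Rule as (T c) (s c) (m c) (x c) (y c) := by
  have left : ∀ {f : γ → ℕ}, Primrec f → Primrec fun c => (f c).unpair.1 :=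
    fun h => Primrec.fst.comp (Primrec.unpair.comp h)
  have right : ∀ {f : γ → ℕ}, Primrec f → Primrec fun c => (f c).unpair.2 :=
    fun h => Primrec.snd.comp (Primrec.unpair.comp h)
  have tag : ∀ k, PrimrecPred fun c => (m c).unpair.1 = k :=
    fun k => Primrec.eq.comp (left hm) (Primrec.const k)
  have hr := right hm
  have hu := primrec_pick (left hr) hx hy
  have hv := primrec_pick (right hr) hx hy
  have hentry : ∀ {f : γ → ℕ}, Primrec f → PrimrecPred fun c => (f c, x c, y c) ∈ T c :=
    fun h => primrecRel_mem.comp (Primrec.pair h (Primrec.pair hx hy)) hT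
  have hw : ∀ {f g : γ → ℕ}, Primrec f → Primrec g →
      Primrec fun c => witnesses as (T c) (s c) (f c) (g c) (x c) (y c) :=
    fun hf hg => primrec_witnesses as hT hs hf hg hx hy
  refine ((tag 0).and (Primrec.eq.comp hu hv)).or <|
    ((tag 1).and (primrecRel_sublist.comp hu hv)).or <|
    ((tag 2).and ((primrecRel_sublist.comp hu hv).and (Primrec.eq.comp
      (Primrec.list_length.comp hv) (Primrec.succ.comp (Primrec.list_length.comp hu))))).or <|
    ((tag 3).and (primrecRel_language.comp hu (Primrec.option_getD.comp
      (Primrec.decode.comp (right hr)) (Primrec.const ([], [], []))))).or <|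
    ((tag 4).and (hentry hr).not).or <|
    ((tag 5).and ((hentry (left hr)).and (hentry (right hr)))).or <|
    ((tag 6).and (Primrec.nat_le.comp (Primrec.const 1)
      (Primrec.list_length.comp (hw (right hr) (left hr))))).or <|
    ((tag 7).and ((primrecPred_exists_long (hw (right (right hr)) (left (right hr))) hs).or
      (Primrec.nat_le.comp (left hr)
        (Primrec.list_length.comp (hw (right (right hr)) (left (right hr))))))).or <|
    (tag 8).and ((primrecPred_exists_long
      (hw (right (right (right hr))) (left (right (right hr)))) hs).not.and
      (Primrec.eq.comp (Primrec.nat_mod.comp (Primrec.list_length.comp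
        (hw (right (right (right hr))) (left (right (right hr))))) (left (right hr))) (left hr)))

theorem primrec_pow : Primrec₂ fun a b : ℕ => a ^ b :=
  Primrec₂.unpaired'.1 Nat.Primrec.pow

theorem primrec_stateBound (c : ℕ) : Primrec (stateBound c) := by
  refine Primrec.nat_rec₁ _
    (f := fun n N => 2 ^ (n + 1) + (N * N + (N + N * (n + 3) ^ (c * N)))) ?_
  have hn : Primrec fun p : ℕ × ℕ => p.1 := Primrec.fst
  have hN : Primrec fun p : ℕ × ℕ => p.2 := Primrec.snd
  exact Primrec.nat_add.comp (primrec_pow.comp (Primrec.const 2) (Primrec.succ.comp hn))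
    (Primrec.nat_add.comp (Primrec.nat_mul.comp hN hN) (Primrec.nat_add.comp hN
      (Primrec.nat_mul.comp hN (primrec_pow.comp (Primrec.nat_add.comp hn (Primrec.const 3))
        (Primrec.nat_mul.comp (Primrec.const c) hN)))))

theorem primrec_sectionBound : Primrec₂ sectionBound := by
  have h : Primrec fun p : ℕ × ℕ => 2 ^ (p.2 + 1) :=
    primrec_pow.comp (Primrec.const 2) (Primrec.succ.comp Primrec.snd)
  exact Primrec.nat_mul.comp Primrec.fst (Primrec.nat_mul.comp h (Primrec.nat_mul.comp h
    (Primrec.nat_add.comp Primrec.snd (Primrec.const 3))))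

theorem primrec_lengthBound {N l j : γ → ℕ} (hN : Primrec N) (hl : Primrec l) (hj : Primrec j) :
    Primrec fun c => lengthBound (N c) (l c) (j c) :=
  Primrec.nat_rec' hj hl (h := fun c p => 2 * sectionBound (N c) p.2)
    (Primrec.nat_mul.comp (Primrec.const 2) (primrec_sectionBound.comp (hN.comp Primrec.fst)
      (Primrec.snd.comp Primrec.snd)))

theorem primrec_tableStep (as : List A) {N l m : γ → ℕ} {T : γ → Table A} (hN : Primrec N)
    (hl : Primrec l) (hm : Primrec m) (hT : Primrec T) :
    Primrec fun c => tableStep as (N c) (l c) (m c) (T c) := by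
  classical
  have hw := (primrec_wordsLe as).comp hl
  refine Primrec.list_append.comp hT (primrec_filter
    (R := fun (t : ℕ × List A × List A) c =>
      Rule as (T c) (sectionBound (N c) (l c)) t.1 t.2.1 t.2.2) ?_ ?_)
  · refine Primrec.list_flatMap hw (Primrec.list_map (hw.comp Primrec.fst) ?_)
    exact Primrec.pair (hm.comp (Primrec.fst.comp Primrec.fst))
      (Primrec.pair (Primrec.snd.comp Primrec.fst) Primrec.snd)
  · exact primrecPred_rule as (hT.comp Primrec.snd)
      ((primrec_sectionBound.comp hN hl).comp Primrec.snd) (Primrec.fst.comp Primrec.fst)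
      (Primrec.fst.comp (Primrec.snd.comp Primrec.fst))
      (Primrec.snd.comp (Primrec.snd.comp Primrec.fst))

theorem primrec_table (as : List A) {N K l i : γ → ℕ} (hN : Primrec N) (hK : Primrec K)
    (hl : Primrec l) (hi : Primrec i) :
    Primrec fun c => table as (N c) (K c) (l c) (i c) := by
  refine Primrec.nat_rec' hi (Primrec.const []) (h := fun c p =>
    tableStep as (N c) (lengthBound (N c) (l c) (K c - (p.1 + 1))) p.1 p.2) ?_
  have hp : Primrec fun q : γ × (ℕ × Table A) => q.2.1 := Primrec.fst.comp Primrec.snd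
  exact primrec_tableStep as (hN.comp Primrec.fst)
    (primrec_lengthBound (hN.comp Primrec.fst) (hl.comp Primrec.fst)
      (Primrec.nat_sub.comp (hK.comp Primrec.fst) (Primrec.succ.comp hp))) hp
    (Primrec.snd.comp Primrec.snd)

theorem primrecPred_similar {U S : γ → List (List A)} {u v : γ → List A} (hU : Primrec U)
    (hS : Primrec S) (hu : Primrec u) (hv : Primrec v) :
    PrimrecPred fun c => Similar (U c) (S c) (u c) (v c) := by
  classical
  have key : PrimrecRel fun (U : List (List A)) (q : List (List A) × List A × List A) =>
      ∀ t ∈ U, t ++ q.2.1 ∈ q.1 ↔ t ++ q.2.2 ∈ q.1 := by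
    apply PrimrecRel.forall_mem_list
      (R := fun t (q : List (List A) × List A × List A) => t ++ q.2.1 ∈ q.1 ↔ t ++ q.2.2 ∈ q.1)
    have hS : Primrec fun p : List A × (List (List A) × List A × List A) => p.2.1 :=
      Primrec.fst.comp Primrec.snd
    have hq : Primrec fun p : List A × (List (List A) × List A × List A) => p.2.2 :=
      Primrec.snd.comp Primrec.snd
    have h1 : PrimrecPred fun p : List A × (List (List A) × List A × List A) =>
        p.1 ++ p.2.2.1 ∈ p.2.1 :=
      primrecRel_mem.comp (Primrec.list_append.comp Primrec.fst (Primrec.fst.comp hq)) hS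
    have h2 : PrimrecPred fun p : List A × (List (List A) × List A × List A) =>
        p.1 ++ p.2.2.2 ∈ p.2.1 :=
      primrecRel_mem.comp (Primrec.list_append.comp Primrec.fst (Primrec.snd.comp hq)) hS
    exact ((h1.and h2).or (h1.not.and h2.not)).of_eq fun p => by tauto
  exact key.comp hU (Primrec.pair hS (Primrec.pair hu hv))

theorem primrec_syntacticAutomaton (as : List A) {n k : γ → ℕ} {S : γ → List (List A)}
    (hn : Primrec n) (hk : Primrec k) (hS : Primrec S) :
    Primrec fun c => syntacticAutomaton as (n c) (k c) (S c) := by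
  classical
  have hW := (primrec_wordsLe as).comp hn
  have hU := (primrec_wordsLe as).comp hk
  have henc : Primrec₂ fun (_ : γ) (w : List A) => Encodable.encode w :=
    Primrec.encode.comp Primrec.snd
  refine Primrec.pair (Primrec.list_map (primrec_filter (R := fun w c => w ∈ S c) hW
    (primrecRel_mem.comp Primrec.fst (hS.comp Primrec.snd))) henc) (Primrec.pair ?_
    (Primrec.list_map (primrec_filter
      (R := fun v c => Similar (wordsLe as (k c)) (S c) v []) hW ?_) henc))
  · refine Primrec.list_flatMap hW (Primrec.list_flatMap (Primrec.const as)
      (Primrec.list_map (primrec_filter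
        (R := fun u (p : (γ × List A) × A) =>
          Similar (wordsLe as (k p.1.1)) (S p.1.1) p.1.2 (p.2 :: u)) ?_ ?_) ?_))
    · exact hW.comp (Primrec.fst.comp Primrec.fst)
    · have hc : Primrec fun p : List A × ((γ × List A) × A) => p.2.1.1 :=
        Primrec.fst.comp (Primrec.fst.comp Primrec.snd)
      exact primrecPred_similar (hU.comp hc) (hS.comp hc)
        (Primrec.snd.comp (Primrec.fst.comp Primrec.snd))
        (Primrec.list_cons.comp (Primrec.snd.comp Primrec.snd) Primrec.fst)
    · exact Primrec.pair (Primrec.encode.comp (Primrec.snd.comp (Primrec.fst.comp Primrec.fst)))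
        (Primrec.pair (Primrec.snd.comp Primrec.fst) (Primrec.encode.comp Primrec.snd))
  · exact primrecPred_similar (hU.comp Primrec.snd) (hS.comp Primrec.snd) Primrec.fst
      (Primrec.const [])

theorem primrec_formulaAutomaton (as : List A) (c : ℕ) : Primrec (formulaAutomaton as c) := by
  classical
  have hN : Primrec fun n => stateBound c (n + 1) := (primrec_stateBound c).comp Primrec.succ
  have hNN := Primrec.nat_mul.comp hN hN
  have hl := Primrec.succ.comp (Primrec.nat_add.comp hNN hN)
  refine primrec_syntacticAutomaton as hN hNN (primrec_filter
    (R := fun w n => (n, w, w) ∈ table as (stateBound c (n + 1)) (n + 1)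
      (stateBound c (n + 1) * stateBound c (n + 1) + stateBound c (n + 1) + 1) (n + 1))
    ((primrec_wordsLe as).comp hl) ?_)
  exact primrecRel_mem.comp (Primrec.pair Primrec.snd (Primrec.pair Primrec.fst Primrec.fst))
    ((primrec_table as hN Primrec.succ hl Primrec.succ).comp Primrec.snd)

end Computability

end SubwordLogic

theorem theorem4p9 {A : Type*} [Finite A] [Primcodable A] (x : Fin 2) :
    ∃ f : ℕ → SubwordLogic.AutomatonCode A, Computable f ∧
      ∀ φ : SubwordLogic.Formula2 A, φ.freeVars ⊆ {x} →
        (φ.definedSet x).IsRegular ∧ (f φ.code).language = φ.definedSet x := by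
  classical
  cases nonempty_fintype A
  have h := fun (φ : SubwordLogic.Formula2 A) (hφ : φ.freeVars ⊆ {x}) =>
    SubwordLogic.formulaAutomaton_language (as := Finset.univ.toList) (by simp)
      (Finset.nodup_toList _) hφ
  exact ⟨_, (SubwordLogic.primrec_formulaAutomaton _ _).to_comp, fun φ hφ =>
    ⟨(SubwordLogic.AutomatonCode.exists_language_eq_iff _).1 ⟨_, h φ hφ⟩, h φ hφ⟩⟩
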